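/- Let $\mathbb D$ be the open unit disc in $\mathbb C$, let $H(\mathbb D)$ be the space of analytic functions on $\mathbb D$, and let $dA=\frac{dx\,dy}{\pi}$. For $f\in H(\mathbb D)$ and $0\le r<1$ put $M_s(r,f)=\left(\frac1{2\pi}\int_0^{2\pi}|f(re^{i\theta})|^s\,d\theta\right)^{1/s}$. Define - the Bloch space $\mathcal B=\{f\in H(\mathbb D):\ \sup_{z\in\mathbb D}(1-|z|^2)|f'(z)|<\infty\}$; - the mean Lipschitz space $\Lambda^s_{1/s}=\{f\in H(\mathbb D):\ \sup_{0\le r<1}(1-r)^{1-1/s}M_s(r,f')<\infty\}$ for $1<s<\infty$; - the Besov space $B_1=\{f\in H(\mathbb D):\ \int_{\mathbb D}|f''|\,dA<\infty\}$, with the norm $\|f\|_{B_1}=|f(0)|+|f'(0)|+\int_{\mathbb D}|f''|\,dA$. Let $\mu$ be a finite positive Borel measure on $[0,1)$ with moments $\mu_n=\int_{[0,1)}t^n\,d\mu(t)$. For $\alpha>0$ and $f(z)=\sum_{k\ge0}a_kz^k\in H(\mathbb D)$ let $$\mathcal C_{\mu,\alpha}(f)(z)=\sum_{n=0}^\infty\left(\mu_n\sum_{k=0}^n\frac{\Gamma(n-k+\alpha)}{\Gamma(\alpha)\,(n-k)!}\,a_k\right)z^n,\qquad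 z\in\mathbb D.$$ Let $1\le\alpha<\infty$ and $1<s<\infty$, and let $X$ be a Banach subspace of $H(\mathbb D)$, that is, a linear subspace of $H(\mathbb D)$ with a complete norm for which the point evaluations $f\mapsto f(z)$, $z\in\mathbb D$, are continuous. Suppose that $\Lambda^s_{1/s}\subset X\subset\mathcal B$. Then the following statements are equivalent: 1. $\mathcal C_{\mu,\alpha}$ maps $X$ into $B_1$ and is bounded from $X$ to $B_1$; 2. $\mathcal C_{\mu,\alpha}$ maps $X$ into $B_1$ and is compact from $X$ to $B_1$; 3. $\displaystyle\sum_{n=0}^\infty (n+1)^{\alpha-1}\mu_n\log(n+2)<\infty$; 4. $\displaystyle\int_{[0,1)}\frac{\log\frac{e}{1-t}}{(1-t)^\alpha}\,d\mu(t)<\infty$. -/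

import Mathlib

open MeasureTheory

/-- The open unit disc. -/
abbrev unitDisk : Set ℂ := Metric.ball 0 1

/-- The vector space `H(𝔻)` of analytic functions in the unit disc. A function on the disc is
represented by its extension by `0` to the plane, so that equality in this type is equality on the
disc and `deriv` may be used at the points of the disc. -/
def HolDisk : Submodule ℂ (ℂ → ℂ) where
  carrier := {f | DifferentiableOn ℂ f unitDisk ∧ ∀ z ∉ unitDisk, f z = 0}
  add_mem' := fun {f g} hf hg =>
    ⟨hf.1.add hg.1, fun z hz => by simp [hf.2 z hz, hg.2 z hz]⟩
  zero_mem' := ⟨differentiableOn_const 0, fun _ _ => rfl⟩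
  smul_mem' := fun c f hf => ⟨hf.1.const_smul c, fun z hz => by simp [hf.2 z hz]⟩

/-- The Bloch space: `sup_{z ∈ 𝔻} (1 - |z|²) |f'(z)| < ∞`. -/
def blochSpace : Set HolDisk :=
  {f | ∃ M : ℝ, ∀ z ∈ unitDisk, (1 - ‖z‖ ^ 2) * ‖deriv (f : ℂ → ℂ) z‖ ≤ M}

/-- The integral mean `M_p(r, g) = ((2π)⁻¹ ∫_0^{2π} |g(r e^{iθ})|^p dθ)^{1/p}`. -/
noncomputable def integralMean (p r : ℝ) (g : ℂ → ℂ) : ℝ :=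
  (Real.circleAverage (fun z => ‖g z‖ ^ p) 0 r) ^ (1 / p)

/-- The mean Lipschitz space `Λ^p_β`: `sup_{0 ≤ r < 1} (1 - r)^{1 - β} M_p(r, f') < ∞`. -/
def meanLipschitzSpace (p β : ℝ) : Set HolDisk :=
  {f | ∃ M : ℝ, ∀ r : ℝ, 0 ≤ r → r < 1 →
    (1 - r) ^ (1 - β) * integralMean p r (deriv (f : ℂ → ℂ)) ≤ M}

/-! ### The Besov space `B_1` -/

theorem HolDisk.analyticOnNhd (f : HolDisk) : AnalyticOnNhd ℂ (f : ℂ → ℂ) unitDisk :=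
  f.2.1.analyticOnNhd Metric.isOpen_ball

theorem HolDisk.deriv_add {f g : HolDisk} {z : ℂ} (hz : z ∈ unitDisk) :
    deriv ((f + g : HolDisk) : ℂ → ℂ) z = deriv (f : ℂ → ℂ) z + deriv (g : ℂ → ℂ) z :=
  _root_.deriv_add (HolDisk.analyticOnNhd f z hz).differentiableAt (HolDisk.analyticOnNhd g z hz).differentiableAt

theorem HolDisk.deriv_smul (c : ℂ) {f : HolDisk} {z : ℂ} (hz : z ∈ unitDisk) :
    deriv ((c • f : HolDisk) : ℂ → ℂ) z = c • deriv (f : ℂ → ℂ) z :=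
  deriv_const_smul c (HolDisk.analyticOnNhd f z hz).differentiableAt

theorem HolDisk.deriv2_add {f g : HolDisk} {z : ℂ} (hz : z ∈ unitDisk) :
    deriv (deriv ((f + g : HolDisk) : ℂ → ℂ)) z
      = deriv (deriv (f : ℂ → ℂ)) z + deriv (deriv (g : ℂ → ℂ)) z := by
  have h : deriv ((f + g : HolDisk) : ℂ → ℂ) =ᶠ[nhds z]
      (deriv (f : ℂ → ℂ) + deriv (g : ℂ → ℂ)) := by
    filter_upwards [Metric.isOpen_ball.mem_nhds hz] with w hw using HolDisk.deriv_add hw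
  rw [h.deriv_eq]
  exact _root_.deriv_add (HolDisk.analyticOnNhd f z hz).deriv.differentiableAt
    (HolDisk.analyticOnNhd g z hz).deriv.differentiableAt

theorem HolDisk.deriv2_smul (c : ℂ) {f : HolDisk} {z : ℂ} (hz : z ∈ unitDisk) :
    deriv (deriv ((c • f : HolDisk) : ℂ → ℂ)) z = c • deriv (deriv (f : ℂ → ℂ)) z := by
  have h : deriv ((c • f : HolDisk) : ℂ → ℂ) =ᶠ[nhds z] (c • deriv (f : ℂ → ℂ)) := by
    filter_upwards [Metric.isOpen_ball.mem_nhds hz] with w hw using HolDisk.deriv_smul c hw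
  rw [h.deriv_eq]
  exact deriv_const_smul c (HolDisk.analyticOnNhd f z hz).deriv.differentiableAt

/-- The vector space of all `f ∈ H(𝔻)` with `∫_𝔻 |f''| dA < ∞`. -/
def besovOneSubmodule : Submodule ℂ HolDisk where
  carrier := {f | IntegrableOn (deriv (deriv (f : ℂ → ℂ))) unitDisk volume}
  add_mem' := fun {f g} hf hg =>
    IntegrableOn.congr_fun (f := deriv (deriv (f : ℂ → ℂ)) + deriv (deriv (g : ℂ → ℂ)))
      (IntegrableOn.add (Set.mem_ofPred.1 hf) (Set.mem_ofPred.1 hg))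
      (fun _ hz => (HolDisk.deriv2_add hz).symm) measurableSet_ball
  zero_mem' := by
    have h : deriv (deriv ((0 : HolDisk) : ℂ → ℂ)) = 0 := by
      have h0 : ((0 : HolDisk) : ℂ → ℂ) = fun _ => 0 := rfl
      rw [h0]; ext z; simp
    show IntegrableOn (deriv (deriv ((0 : HolDisk) : ℂ → ℂ))) unitDisk
    rw [h]
    exact integrableOn_zero
  smul_mem' := fun c f hf =>
    IntegrableOn.congr_fun (f := c • deriv (deriv (f : ℂ → ℂ)))
      (Integrable.smul c (Set.mem_ofPred.1 hf))
      (fun _ hz => (HolDisk.deriv2_smul c hz).symm) measurableSet_ball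

/-- The Besov space `B_1`, as a type carrying the norm topology defined below. -/
def BesovOne : Type := ↥besovOneSubmodule

noncomputable instance : AddCommGroup BesovOne := inferInstanceAs (AddCommGroup besovOneSubmodule)

noncomputable instance : Module ℂ BesovOne := inferInstanceAs (Module ℂ besovOneSubmodule)

/-- The inclusion of `B_1` in `H(𝔻)`. -/
def BesovOne.toHol : BesovOne →ₗ[ℂ] HolDisk := besovOneSubmodule.subtype

/-- `‖f‖ = |f(0)| + |f'(0)| + ∫_𝔻 |f''| dA`, where `dA = dx dy / π`. -/
noncomputable instance : Norm BesovOne where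
  norm f := ‖(f.toHol : ℂ → ℂ) 0‖ + ‖deriv (f.toHol : ℂ → ℂ) 0‖
    + Real.pi⁻¹ * ∫ z in unitDisk, ‖deriv (deriv (f.toHol : ℂ → ℂ)) z‖

theorem BesovOne.norm_def (f : BesovOne) :
    ‖f‖ = ‖(f.toHol : ℂ → ℂ) 0‖ + ‖deriv (f.toHol : ℂ → ℂ) 0‖
      + Real.pi⁻¹ * ∫ z in unitDisk, ‖deriv (deriv (f.toHol : ℂ → ℂ)) z‖ := rfl

theorem BesovOne.integrableOn (f : BesovOne) :
    IntegrableOn (deriv (deriv (f.toHol : ℂ → ℂ))) unitDisk := f.2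

theorem BesovOne.toHol_injective : Function.Injective BesovOne.toHol :=
  besovOneSubmodule.subtype_injective

theorem BesovOne.integral_nonneg (f : BesovOne) :
    0 ≤ Real.pi⁻¹ * ∫ z in unitDisk, ‖deriv (deriv (f.toHol : ℂ → ℂ)) z‖ :=
  mul_nonneg (inv_nonneg.2 Real.pi_pos.le) (MeasureTheory.integral_nonneg fun _ => norm_nonneg _)

theorem BesovOne.eq_zero_of_norm (f : BesovOne) (hf : ‖f‖ = 0) : f = 0 := by
  rw [BesovOne.norm_def] at hf
  have h1 := norm_nonneg ((f.toHol : ℂ → ℂ) 0)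
  have h2 := norm_nonneg (deriv (f.toHol : ℂ → ℂ) 0)
  have h3 := f.integral_nonneg
  have e1 : (f.toHol : ℂ → ℂ) 0 = 0 := norm_eq_zero.1 (by linarith)
  have e2 : deriv (f.toHol : ℂ → ℂ) 0 = 0 := norm_eq_zero.1 (by linarith)
  have e3 : ∫ z in unitDisk, ‖deriv (deriv (f.toHol : ℂ → ℂ)) z‖ = 0 := by
    have : Real.pi⁻¹ * ∫ z in unitDisk, ‖deriv (deriv (f.toHol : ℂ → ℂ)) z‖ = 0 := by linarith
    exact (mul_eq_zero.1 this).resolve_left (inv_ne_zero Real.pi_ne_zero)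
  have hd : DifferentiableOn ℂ (deriv (f.toHol : ℂ → ℂ)) unitDisk :=
    (HolDisk.analyticOnNhd f.toHol).deriv.differentiableOn
  have hc : ContinuousOn (deriv (deriv (f.toHol : ℂ → ℂ))) unitDisk :=
    (HolDisk.analyticOnNhd f.toHol).deriv.deriv.continuousOn
  have hae : deriv (deriv (f.toHol : ℂ → ℂ)) =ᵐ[volume.restrict unitDisk] fun _ => 0 := by
    have := (setIntegral_eq_zero_iff_of_nonneg_ae
      (Filter.Eventually.of_forall fun _ => norm_nonneg _) f.integrableOn.norm).1 e3
    filter_upwards [this] with z hz using by simpa using hz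
  have z2 : Set.EqOn (deriv (deriv (f.toHol : ℂ → ℂ))) (fun _ => 0) unitDisk :=
    Measure.eqOn_open_of_ae_eq hae Metric.isOpen_ball hc continuousOn_const
  have hpre : IsPreconnected unitDisk := (convex_ball (0 : ℂ) 1).isPreconnected
  have h0 : (0 : ℂ) ∈ unitDisk := by simp
  have z1 : Set.EqOn (deriv (f.toHol : ℂ → ℂ)) 0 unitDisk := fun z hz => by
    have := Metric.isOpen_ball.is_const_of_deriv_eq_zero hpre hd (fun w hw => z2 hw) hz h0
    simpa [e2] using this
  have z0 : ∀ z ∈ unitDisk, (f.toHol : ℂ → ℂ) z = 0 := fun z hz => by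
    have := Metric.isOpen_ball.is_const_of_deriv_eq_zero hpre f.toHol.2.1 z1 hz h0
    simpa [e1] using this
  apply BesovOne.toHol_injective
  rw [map_zero]
  apply Subtype.ext
  ext z
  by_cases hz : z ∈ unitDisk
  · exact z0 z hz
  · exact f.toHol.2.2 z hz

theorem BesovOne.normCore : NormedSpace.Core ℂ BesovOne where
  norm_nonneg f := by
    rw [BesovOne.norm_def]
    have := f.integral_nonneg
    positivity
  norm_smul c f := by
    have h0 : (0 : ℂ) ∈ unitDisk := by simp
    have hi : ∫ z in unitDisk, ‖deriv (deriv ((c • f.toHol : HolDisk) : ℂ → ℂ)) z‖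
        = ‖c‖ * ∫ z in unitDisk, ‖deriv (deriv (f.toHol : ℂ → ℂ)) z‖ := by
      rw [← integral_const_mul]
      refine setIntegral_congr_fun measurableSet_ball fun z hz => ?_
      simp only [HolDisk.deriv2_smul c hz, norm_smul]
    have hv : ((c • f.toHol : HolDisk) : ℂ → ℂ) 0 = c • (f.toHol : ℂ → ℂ) 0 := rfl
    rw [BesovOne.norm_def, BesovOne.norm_def, map_smul, hi, HolDisk.deriv_smul c h0, hv,
      norm_smul, norm_smul]
    ring
  norm_triangle f g := by
    have h0 : (0 : ℂ) ∈ unitDisk := by simp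
    have hi : ∫ z in unitDisk, ‖deriv (deriv ((f.toHol + g.toHol : HolDisk) : ℂ → ℂ)) z‖
        ≤ (∫ z in unitDisk, ‖deriv (deriv (f.toHol : ℂ → ℂ)) z‖)
          + ∫ z in unitDisk, ‖deriv (deriv (g.toHol : ℂ → ℂ)) z‖ := by
      rw [← integral_add f.integrableOn.norm g.integrableOn.norm]
      refine setIntegral_mono_on ?_ (f.integrableOn.norm.add g.integrableOn.norm)
        measurableSet_ball fun z hz => ?_
      · rw [← map_add]; exact (f + g).integrableOn.norm
      · simp only [HolDisk.deriv2_add hz]; exact norm_add_le _ _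
    have hv : ((f.toHol + g.toHol : HolDisk) : ℂ → ℂ) 0
      = (f.toHol : ℂ → ℂ) 0 + (g.toHol : ℂ → ℂ) 0 := rfl
    rw [BesovOne.norm_def, BesovOne.norm_def, BesovOne.norm_def, map_add,
      HolDisk.deriv_add h0, hv]
    have a := norm_add_le ((f.toHol : ℂ → ℂ) 0) ((g.toHol : ℂ → ℂ) 0)
    have b := norm_add_le (deriv (f.toHol : ℂ → ℂ) 0) (deriv (g.toHol : ℂ → ℂ) 0)
    have d := mul_le_mul_of_nonneg_left hi (inv_nonneg.2 Real.pi_pos.le)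
    rw [mul_add] at d
    linarith
  norm_eq_zero_iff f := by
    refine ⟨BesovOne.eq_zero_of_norm f, ?_⟩
    rintro rfl
    have h : ((0 : HolDisk) : ℂ → ℂ) = fun _ => 0 := rfl
    have h' : deriv (fun _ : ℂ => (0 : ℂ)) = fun _ => 0 := by ext z; simp
    rw [BesovOne.norm_def, map_zero, h, h', h']
    simp

noncomputable instance : NormedAddCommGroup BesovOne := NormedAddCommGroup.ofCore BesovOne.normCore

noncomputable instance : NormedSpace ℂ BesovOne := NormedSpace.ofCore BesovOne.normCore

/-! ### The generalized Cesàro-like operator -/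

/-- The moment `μ_n = ∫_{[0,1)} t^n dμ(t)`. -/
noncomputable def moment (μ : Measure (Set.Ico (0 : ℝ) 1)) (n : ℕ) : ℝ :=
  ∫ t, (t : ℝ) ^ n ∂μ

/-- The Taylor coefficient `a_k` of `f` at `0`. -/
noncomputable def taylorCoeff (f : ℂ → ℂ) (k : ℕ) : ℂ := iteratedDeriv k f 0 / (k.factorial : ℂ)

/-- The coefficient `Γ(m + α) / (Γ(α) m!)`. -/
noncomputable def gammaCoeff (α : ℝ) (m : ℕ) : ℝ :=
  Real.Gamma (m + α) / (Real.Gamma α * m.factorial)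

/-- `μ_n ∑_{k=0}^n Γ(n-k+α) / (Γ(α) (n-k)!) a_k`. -/
noncomputable def cesaroCoeff (μ : Measure (Set.Ico (0 : ℝ) 1)) (α : ℝ) (f : ℂ → ℂ) (n : ℕ) : ℂ :=
  (moment μ n : ℂ) * ∑ k ∈ Finset.range (n + 1), (gammaCoeff α (n - k) : ℂ) * taylorCoeff f k

theorem abs_moment_le (μ : Measure (Set.Ico (0 : ℝ) 1)) [IsFiniteMeasure μ] (n : ℕ) :
    |moment μ n| ≤ μ.real Set.univ := by
  have h := norm_integral_le_of_norm_le_const (μ := μ) (f := fun t => (t : ℝ) ^ n) (C := 1)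
    (Filter.Eventually.of_forall fun t => by
      rw [Real.norm_eq_abs, abs_of_nonneg (pow_nonneg t.2.1 n)]
      exact pow_le_one₀ t.2.1 t.2.2.le)
  simpa [moment] using h

theorem HolDisk.summable_taylor (f : HolDisk) {r : ℝ} (h0 : 0 ≤ r) (h1 : r < 1) :
    Summable fun k => ‖taylorCoeff f k * (r : ℂ) ^ k‖ := by
  have hz : (r : ℂ) ∈ Metric.ball (0 : ℂ) 1 := by
    simp [abs_of_nonneg h0, h1]
  have := (Complex.hasSum_taylorSeries_on_ball f.2.1 hz).summable.norm
  refine this.congr fun k => ?_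
  congr 1
  simp only [taylorCoeff, sub_zero, smul_eq_mul]
  ring

theorem summable_gammaCoeff {α : ℝ} (hα : 0 < α) {r : ℝ} (h0 : 0 ≤ r) (h1 : r < 1) :
    Summable fun m => ‖(gammaCoeff α m : ℂ) * (r : ℂ) ^ m‖ := by
  rcases h0.eq_or_lt with rfl | h0
  · refine summable_of_ne_finset_zero (s := {0}) fun m hm => ?_
    have : m ≠ 0 := by simpa using hm
    simp [this]
  have hpos : ∀ m : ℕ, 0 < gammaCoeff α m := fun m =>
    div_pos (Real.Gamma_pos_of_pos (by positivity))
      (mul_pos (Real.Gamma_pos_of_pos hα) (by positivity))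
  have hrec : ∀ m : ℕ, gammaCoeff α (m + 1) = (m + α) / (m + 1) * gammaCoeff α m := fun m => by
    have h2 : ((m + 1 : ℕ) : ℝ) + α = (m + α) + 1 := by push_cast; ring
    have h3 : (0 : ℝ) < m + α := by positivity
    have h4 := (Real.Gamma_pos_of_pos hα).ne'
    rw [gammaCoeff, gammaCoeff, h2, Real.Gamma_add_one h3.ne', Nat.factorial_succ]
    push_cast
    field_simp
  have hs : Summable fun m => gammaCoeff α m * r ^ m := by
    refine summable_of_ratio_test_tendsto_lt_one h1
      (Filter.Eventually.of_forall fun m => (mul_pos (hpos m) (pow_pos h0 m)).ne') ?_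
    have hlim : Filter.Tendsto (fun m : ℕ => ((m : ℝ) + α) / (m + 1) * r) Filter.atTop
        (nhds r) := by
      have := (tendsto_add_mul_div_add_mul_atTop_nhds α 1 (1 : ℝ) (d := 1) one_ne_zero)
      have := this.mul_const r
      simp only [div_one, one_mul] at this
      refine this.congr fun m => ?_
      ring
    refine hlim.congr fun m => ?_
    rw [Real.norm_of_nonneg (mul_pos (hpos _) (pow_pos h0 _)).le,
      Real.norm_of_nonneg (mul_pos (hpos _) (pow_pos h0 _)).le, hrec, pow_succ]
    have := (hpos m).ne'
    field_simp
  refine hs.congr fun m => ?_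
  rw [norm_mul, norm_pow, Complex.norm_real, Complex.norm_real,
    Real.norm_of_nonneg (hpos m).le, Real.norm_of_nonneg h0.le]

theorem summable_cesaro (μ : Measure (Set.Ico (0 : ℝ) 1)) [IsFiniteMeasure μ] {α : ℝ} (hα : 0 < α)
    (f : HolDisk) {r : ℝ} (h0 : 0 ≤ r) (h1 : r < 1) :
    Summable fun n => ‖cesaroCoeff μ α f n‖ * r ^ n := by
  have h := (summable_norm_sum_mul_range_of_summable_norm (HolDisk.summable_taylor f h0 h1)
    (summable_gammaCoeff hα h0 h1)).mul_left (μ.real Set.univ)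
  refine Summable.of_nonneg_of_le (fun n => by positivity) (fun n => ?_) h
  have e : ∑ k ∈ Finset.range (n + 1), taylorCoeff f k * (r : ℂ) ^ k *
        ((gammaCoeff α (n - k) : ℂ) * (r : ℂ) ^ (n - k))
      = (∑ k ∈ Finset.range (n + 1), (gammaCoeff α (n - k) : ℂ) * taylorCoeff f k)
        * (r : ℂ) ^ n := by
    rw [Finset.sum_mul]
    refine Finset.sum_congr rfl fun k hk => ?_
    have hk' : k + (n - k) = n := by
      have := Finset.mem_range.1 hk
      omega
    rw [← hk', pow_add, hk']
    ring
  rw [e, cesaroCoeff, norm_mul, norm_mul, norm_pow, Complex.norm_real, Complex.norm_real,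
    Real.norm_of_nonneg h0, mul_assoc]
  exact mul_le_mul_of_nonneg_right (abs_moment_le μ n) (by positivity)

theorem summable_cesaro_apply (μ : Measure (Set.Ico (0 : ℝ) 1)) [IsFiniteMeasure μ] {α : ℝ}
    (hα : 0 < α) (f : HolDisk) {z : ℂ} (hz : z ∈ unitDisk) :
    Summable fun n => cesaroCoeff μ α f n * z ^ n := by
  refine Summable.of_norm ?_
  refine (summable_cesaro μ hα f (norm_nonneg z) (by simpa using hz)).congr fun n => ?_
  rw [norm_mul, norm_pow]

theorem taylorCoeff_add (f g : HolDisk) (k : ℕ) :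
    taylorCoeff ((f + g : HolDisk) : ℂ → ℂ) k = taylorCoeff f k + taylorCoeff g k := by
  have h0 : (0 : ℂ) ∈ unitDisk := by simp
  have : iteratedDeriv k ((f : ℂ → ℂ) + (g : ℂ → ℂ)) 0
      = iteratedDeriv k (f : ℂ → ℂ) 0 + iteratedDeriv k (g : ℂ → ℂ) 0 :=
    iteratedDeriv_add (HolDisk.analyticOnNhd f 0 h0).contDiffAt (HolDisk.analyticOnNhd g 0 h0).contDiffAt
  rw [taylorCoeff, taylorCoeff, taylorCoeff, Submodule.coe_add, this, add_div]

theorem taylorCoeff_smul (c : ℂ) (f : HolDisk) (k : ℕ) :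
    taylorCoeff ((c • f : HolDisk) : ℂ → ℂ) k = c * taylorCoeff f k := by
  have h0 : (0 : ℂ) ∈ unitDisk := by simp
  have : iteratedDeriv k (c • (f : ℂ → ℂ)) 0 = c • iteratedDeriv k (f : ℂ → ℂ) 0 :=
    iteratedDeriv_const_smul (HolDisk.analyticOnNhd f 0 h0).contDiffAt c
  rw [taylorCoeff, taylorCoeff, Submodule.coe_smul, this, smul_eq_mul, mul_div_assoc]

open Classical in
/-- The operator `C_{μ,α}` on `H(𝔻)`:
`C_{μ,α}(f)(z) = ∑_n (μ_n ∑_{k=0}^n Γ(n-k+α) / (Γ(α) (n-k)!) a_k) z^n` for `z ∈ 𝔻`. -/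
noncomputable def cesaroOp (μ : Measure (Set.Ico (0 : ℝ) 1)) [IsFiniteMeasure μ] (α : ℝ)
    (hα : 0 < α) : HolDisk →ₗ[ℂ] HolDisk where
  toFun f := ⟨fun z => if z ∈ unitDisk then ∑' n, cesaroCoeff μ α f n * z ^ n else 0, by
    refine ⟨?_, fun z hz => if_neg hz⟩
    have key : DifferentiableOn ℂ (fun z => ∑' n, cesaroCoeff μ α f n * z ^ n) unitDisk := by
      intro z hz
      obtain ⟨r, hzr, hr1⟩ := exists_between (show ‖z‖ < 1 by simpa using hz)
      have h0 : 0 ≤ r := (norm_nonneg z).trans hzr.le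
      have := Complex.differentiableOn_tsum_of_summable_norm
        (F := fun n (w : ℂ) => cesaroCoeff μ α f n * w ^ n) (U := Metric.ball 0 r)
        (summable_cesaro μ hα f h0 hr1) (fun n => by fun_prop) Metric.isOpen_ball
        (fun n w hw => by
          rw [norm_mul, norm_pow]
          have : ‖w‖ ≤ r := by simpa using (mem_ball_zero_iff.1 hw).le
          gcongr)
      exact (this.differentiableAt (Metric.isOpen_ball.mem_nhds (by simpa using hzr))
        ).differentiableWithinAt
    exact key.congr fun z hz => if_pos hz⟩
  map_add' f g := by
    apply Subtype.ext
    ext z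
    by_cases hz : z ∈ unitDisk
    · simp only [Submodule.coe_add, Pi.add_apply, if_pos hz]
      rw [← (summable_cesaro_apply μ hα f hz).tsum_add (summable_cesaro_apply μ hα g hz)]
      refine tsum_congr fun n => ?_
      have h := fun k => taylorCoeff_add f g k
      simp only [Submodule.coe_add] at h
      simp only [cesaroCoeff, h, mul_add, Finset.sum_add_distrib, add_mul]
    · simp only [Submodule.coe_add, Pi.add_apply, if_neg hz, add_zero]
  map_smul' c f := by
    apply Subtype.ext
    ext z
    by_cases hz : z ∈ unitDisk
    · simp only [Submodule.coe_smul, Pi.smul_apply, if_pos hz, RingHom.id_apply, smul_eq_mul]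
      rw [← tsum_mul_left]
      refine tsum_congr fun n => ?_
      have h := fun k => taylorCoeff_smul c f k
      simp only [Submodule.coe_smul] at h
      simp only [cesaroCoeff, h, Finset.mul_sum, Finset.sum_mul]
      refine Finset.sum_congr rfl fun k _ => ?_
      ring
    · simp only [Submodule.coe_smul, Pi.smul_apply, if_neg hz, RingHom.id_apply, smul_zero]

/-- For a normed space `X` embedded in `H(𝔻)` by `ι`: the operator `T` maps `X` into `B_1` and is
bounded from `X` to `B_1`. -/
def IsBoundedToBesovOne {X : Type*} [NormedAddCommGroup X] [NormedSpace ℂ X]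
    (ι : X →ₗ[ℂ] HolDisk) (T : HolDisk →ₗ[ℂ] HolDisk) : Prop :=
  ∃ S : X →L[ℂ] BesovOne, ∀ x, (S x).toHol = T (ι x)

/-- For a normed space `X` embedded in `H(𝔻)` by `ι`: the operator `T` maps `X` into `B_1` and is
a compact (in particular bounded) operator from `X` to `B_1`. -/
def IsCompactToBesovOne {X : Type*} [NormedAddCommGroup X] [NormedSpace ℂ X]
    (ι : X →ₗ[ℂ] HolDisk) (T : HolDisk →ₗ[ℂ] HolDisk) : Prop :=
  ∃ S : X →L[ℂ] BesovOne, IsCompactOperator S ∧ ∀ x, (S x).toHol = T (ι x)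

/-! The coefficients of `C_{μ,α}(f)` are the moments times those of `f(w) / (1 - w)^α`, so
`C_{μ,α}(f)(z) = ∫ f(tz) / (1 - tz)^α dμ(t)`. The integral can be differentiated twice, and
everything reduces to estimates for a fixed `t`.

Condition 4 gives compactness. For a Bloch function, `|f|`, `|f'|`, `|f''|` are at most constants
times `log (e / (1 - |z|))`, `(1 - |z|)⁻¹`, `(1 - |z|)⁻²`. Since `α ≥ 1`, `|1 - tz|^(1 - α) ≤ (1 -
t)^(1 - α)`, and the second derivative of the integrand is dominated by `(1 - t)^(1 - α)` times
`blochKernel`, whose area integral is `O(log (e / (1 - t)) / (1 - t))` (`lintegral_blochKernel_le`).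
By Tonelli, condition 4 says that one integrable function dominates `|F''|` for all images `F` of a
Bloch ball. Bloch balls are compact for coefficientwise convergence, so dominated convergence makes
their images compact in `B_1` (`isCompact_cesaroOp_blochBall`). By uniform boundedness, the unit
ball of `X` lies in a Bloch ball.

Conversely, `log (1 / (1 - z))` belongs to the mean Lipschitz space, hence to `X`. At `ρ ∈ [0, 1)`
its image is the integral of a nonnegative kernel, and functions of `B_1` are bounded on the radius
by their norm (`BesovOne.norm_apply_ofReal_le`). Fatou's lemma as `ρ → 1` gives condition 4.

Conditions 3 and 4 agree because `∑ (n+1)^(α-1) log(n+2) t^n` is comparable to `log (e / (1 - t)) /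
(1 - t)^α`, uniformly in `t`. -/

/-! ### Circle means of powers of `|1 - z|` -/

theorem norm_sq_one_sub_circleMap (r θ : ℝ) :
    ‖1 - circleMap 0 r θ‖ ^ 2 = (1 - r) ^ 2 + 2 * r * (1 - Real.cos θ) := by
  have e : circleMap 0 r θ = ((r * Real.cos θ : ℝ) : ℂ) + ((r * Real.sin θ : ℝ) : ℂ) * Complex.I := by
    rw [circleMap, Complex.exp_mul_I]
    push_cast
    ring
  rw [← Complex.normSq_eq_norm_sq, Complex.normSq_apply, e]
  simp only [Complex.sub_re, Complex.sub_im, Complex.add_re, Complex.add_im, Complex.re_ofReal_mul,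
    Complex.im_ofReal_mul, Complex.ofReal_re, Complex.ofReal_im, Complex.I_re, Complex.I_im,
    Complex.one_re, Complex.one_im]
  linear_combination r ^ 2 * Real.sin_sq_add_cos_sq θ

/-- In the exact formula for `|1 - re^{iθ}|²`, the concavity-type bound `1 - cos θ ≥ 2θ²/π²` makes
the angular term quadratic in `θ` once `r` stays away from `0`. -/
theorem le_norm_one_sub_circleMap {r θ : ℝ} (h0 : 0 ≤ r) (h1 : r < 1) (hθ : |θ| ≤ Real.pi) :
    (1 - r + |θ|) / 10 ≤ ‖1 - circleMap 0 r θ‖ := by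
  refine (abs_le_of_sq_le_sq ?_ (norm_nonneg _)).trans' (le_abs_self _)
  rw [norm_sq_one_sub_circleMap]
  have hc := Real.cos_le_one_sub_mul_cos_sq hθ
  have hpi := Real.pi_lt_d2
  have hpi0 := Real.pi_pos
  -- Here `π² < 10`.
  have h4 : 1 / 5 * θ ^ 2 ≤ 2 / Real.pi ^ 2 * θ ^ 2 := by
    gcongr ?_ * _
    rw [div_le_div_iff₀ (by norm_num) (by positivity)]
    nlinarith
  have h5 : |θ| ^ 2 = θ ^ 2 := sq_abs θ
  -- For small `r` the term `(1 - r)² ≥ 1/4` suffices alone, as `|θ| ≤ 4`; for `r ≥ 1/2` the angular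
  -- term contributes `θ²/5`.
  rcases le_total r (1 / 2) with h | h
  · have : 0 ≤ r * (1 - Real.cos θ) := mul_nonneg h0 (by linarith [Real.cos_le_one θ])
    have : |θ| ≤ 4 := by linarith
    nlinarith [abs_nonneg θ]
  · have : 1 / 2 * (1 / 5 * θ ^ 2) ≤ r * (1 - Real.cos θ) := by
      apply mul_le_mul h (by linarith) (by positivity) h0
    nlinarith [sq_nonneg (1 - r - |θ|)]

theorem one_sub_circleMap_ne_zero {r : ℝ} (h0 : 0 ≤ r) (h1 : r < 1) (θ : ℝ) :
    1 - circleMap 0 r θ ≠ 0 := by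
  intro h
  have := norm_circleMap_zero r θ
  rw [← sub_eq_zero.1 h, norm_one, abs_of_nonneg h0] at this
  linarith

theorem continuous_norm_one_sub_circleMap_rpow {r : ℝ} (h0 : 0 ≤ r) (h1 : r < 1) (p : ℝ) :
    Continuous fun θ => ‖1 - circleMap 0 r θ‖ ^ p :=
  (continuous_const.sub (continuous_circleMap 0 r)).norm.rpow_const
    fun θ => Or.inl (norm_ne_zero_iff.2 (one_sub_circleMap_ne_zero h0 h1 θ))

/-- The lower bound by `(1 - r + |θ|) / 10` is even in `θ`: fold onto `[0, π]` and substitute `x = 1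
- r + θ`. -/
theorem integral_norm_one_sub_circleMap_rpow_le {r p : ℝ} (h0 : 0 ≤ r) (h1 : r < 1) (hp : 0 ≤ p) :
    ∫ θ in -Real.pi..Real.pi, ‖1 - circleMap 0 r θ‖ ^ (-p)
      ≤ 2 * 10 ^ p * ∫ x in (1 - r)..(1 - r + Real.pi), x ^ (-p) := by
  have hpi := Real.pi_pos
  have hcont : Continuous fun θ : ℝ => (1 - r + |θ|) ^ (-p) :=
    (continuous_const.add continuous_abs).rpow_const
      fun θ => Or.inl (ne_of_gt (show 0 < 1 - r + |θ| by linarith [abs_nonneg θ]))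
  have hhalf : ∫ θ in (0 : ℝ)..Real.pi, (1 - r + |θ|) ^ (-p)
      = ∫ x in (1 - r)..(1 - r + Real.pi), x ^ (-p) := by
    have := intervalIntegral.integral_comp_add_left (a := 0) (b := Real.pi)
      (fun x : ℝ => x ^ (-p)) (1 - r)
    rw [add_zero] at this
    rw [← this]
    refine intervalIntegral.integral_congr fun θ hθ => ?_
    rw [Set.uIcc_of_le hpi.le] at hθ
    simp only [abs_of_nonneg hθ.1]
  have hneg : ∫ θ in -Real.pi..0, (1 - r + |θ|) ^ (-p)
      = ∫ θ in (0 : ℝ)..Real.pi, (1 - r + |θ|) ^ (-p) := by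
    have := intervalIntegral.integral_comp_neg (a := 0) (b := Real.pi)
      (fun θ : ℝ => (1 - r + |θ|) ^ (-p))
    simp only [abs_neg, neg_zero] at this
    exact this.symm
  calc ∫ θ in -Real.pi..Real.pi, ‖1 - circleMap 0 r θ‖ ^ (-p)
      ≤ ∫ θ in -Real.pi..Real.pi, 10 ^ p * (1 - r + |θ|) ^ (-p) := by
        refine intervalIntegral.integral_mono_on (by linarith)
          (continuous_norm_one_sub_circleMap_rpow h0 h1 _).continuousOn.intervalIntegrable
          (hcont.const_mul _).continuousOn.intervalIntegrable fun θ hθ => ?_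
        have hpos : 0 < 1 - r + |θ| := by linarith [abs_nonneg θ]
        have := Real.rpow_le_rpow_of_nonpos (z := -p) (by positivity)
          (le_norm_one_sub_circleMap h0 h1 (abs_le.2 hθ)) (by linarith)
        refine this.trans_eq ?_
        rw [Real.div_rpow hpos.le (by norm_num), Real.rpow_neg (by norm_num : (0 : ℝ) ≤ 10),
          div_inv_eq_mul, mul_comm]
    _ = 2 * 10 ^ p * ∫ x in (1 - r)..(1 - r + Real.pi), x ^ (-p) := by
        rw [intervalIntegral.integral_const_mul,
          ← intervalIntegral.integral_add_adjacent_intervals (b := 0)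
            hcont.continuousOn.intervalIntegrable hcont.continuousOn.intervalIntegrable,
          hneg, hhalf]
        ring

theorem integral_norm_one_sub_circleMap_rpow_le_of_one_lt {r p : ℝ} (h0 : 0 ≤ r) (h1 : r < 1)
    (hp : 1 < p) :
    ∫ θ in -Real.pi..Real.pi, ‖1 - circleMap 0 r θ‖ ^ (-p)
      ≤ 2 * 10 ^ p / (p - 1) * (1 - r) ^ (1 - p) := by
  have hpi := Real.pi_pos
  refine (integral_norm_one_sub_circleMap_rpow_le h0 h1 (by linarith)).trans ?_
  rw [integral_rpow (Or.inr ⟨by linarith, fun h => ?_⟩)]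
  · have e : -p + 1 = -(p - 1) := by ring
    have e2 : 1 - p = -(p - 1) := by ring
    have := Real.rpow_nonneg (show 0 ≤ 1 - r + Real.pi by linarith) (-(p - 1))
    have hp' : 0 < p - 1 := by linarith
    rw [e, e2, mul_div_assoc', div_mul_eq_mul_div, div_neg, ← neg_div]
    gcongr
    have : (0 : ℝ) < 10 ^ p := by positivity
    nlinarith
  · rw [Set.uIcc_of_le (by linarith)] at h
    linarith [h.1]

theorem one_le_log_exp_one_div {r : ℝ} (h0 : 0 ≤ r) (h1 : r < 1) :
    1 ≤ Real.log (Real.exp 1 / (1 - r)) := by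
  rw [Real.le_log_iff_exp_le (by have := Real.exp_pos 1; have : 0 < 1 - r := by linarith
                                 positivity), le_div_iff₀ (by linarith)]
  nlinarith [Real.exp_pos 1]

theorem log_exp_one_div {r : ℝ} (h1 : r < 1) :
    Real.log (Real.exp 1 / (1 - r)) = 1 - Real.log (1 - r) := by
  rw [Real.log_div (Real.exp_ne_zero 1) (by linarith), Real.log_exp]

/-- The borderline exponent, where the mean grows logarithmically. With `ℓ = -log (1 - r)`, the
one-dimensional integral is at most `2 + ℓ ≤ 2 (1 + ℓ)`, and `40 = 2 · 10 · 2`. -/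
theorem integral_norm_one_sub_circleMap_inv_le {r : ℝ} (h0 : 0 ≤ r) (h1 : r < 1) :
    ∫ θ in -Real.pi..Real.pi, ‖1 - circleMap 0 r θ‖ ^ (-1 : ℝ)
      ≤ 40 * Real.log (Real.exp 1 / (1 - r)) := by
  have hpi := Real.pi_pos
  have hpi' := Real.pi_lt_d2
  refine (integral_norm_one_sub_circleMap_rpow_le h0 h1 zero_le_one).trans ?_
  have h : ∫ x in (1 - r)..(1 - r + Real.pi), x ^ (-1 : ℝ)
      = Real.log ((1 - r + Real.pi) / (1 - r)) := by
    simp_rw [Real.rpow_neg_one]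
    refine integral_inv fun h => ?_
    rw [Set.uIcc_of_le (by linarith)] at h
    linarith [h.1]
  have hL := one_le_log_exp_one_div h0 h1
  have h5 : Real.log (1 - r + Real.pi) ≤ 2 := by
    rw [Real.log_le_iff_le_exp (by linarith)]
    have h := Real.exp_one_gt_d9
    have : Real.exp 2 = Real.exp 1 * Real.exp 1 := by rw [← Real.exp_add]; norm_num
    nlinarith
  have h0' : 0 < 1 - r := by linarith
  rw [h, Real.log_div (by positivity) (by linarith), Real.rpow_one]
  rw [log_exp_one_div h1] at hL ⊢
  linarith

/-! ### Area integrals over the disc -/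

theorem lintegral_unitDisk_eq {f : ℂ → ENNReal} (hf : Measurable f) :
    ∫⁻ z in unitDisk, f z = ∫⁻ r in Set.Ioo (0 : ℝ) 1,
      ENNReal.ofReal r * ∫⁻ θ in Set.Ioo (-Real.pi) Real.pi, f (circleMap 0 r θ) := by
  have hcm : Measurable fun p : ℝ × ℝ => circleMap 0 p.1 p.2 := by
    unfold circleMap; fun_prop
  rw [← lintegral_indicator measurableSet_ball, ← Complex.lintegral_comp_polarCoord_symm,
    polarCoord_target, Measure.volume_eq_prod, ← Measure.prod_restrict]
  have e : ∀ p : ℝ × ℝ, Complex.polarCoord.symm p = circleMap 0 p.1 p.2 := fun p => by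
    rw [Complex.polarCoord_symm_apply, circleMap, Complex.exp_mul_I]
    simp
  simp_rw [e, smul_eq_mul]
  rw [lintegral_prod _ (by
    refine (Measurable.mul (by fun_prop) ?_).aemeasurable
    exact (hf.indicator measurableSet_ball).comp hcm)]
  have e1 : Set.Ioo (0 : ℝ) 1 = Set.Iio 1 ∩ Set.Ioi 0 := by
    rw [Set.inter_comm, Set.Ioi_inter_Iio]
  rw [e1, ← setLIntegral_indicator measurableSet_Iio]
  refine setLIntegral_congr_fun measurableSet_Ioi fun r hr => ?_
  rw [Set.mem_Ioi] at hr
  have hmem : ∀ θ, circleMap 0 r θ ∈ unitDisk ↔ r < 1 := fun θ => by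
    rw [mem_ball_zero_iff, norm_circleMap_zero, abs_of_pos hr]
  by_cases h : r < 1
  · rw [Set.indicator_of_mem (Set.mem_Iio.2 h), ← lintegral_const_mul]
    · refine lintegral_congr fun θ => ?_
      rw [Set.indicator_of_mem ((hmem θ).2 h)]
    · exact hf.comp (hcm.comp measurable_prodMk_left)
  · rw [Set.indicator_of_notMem (by simpa using h)]
    refine (lintegral_congr fun θ => ?_).trans lintegral_zero
    rw [Set.indicator_of_notMem (fun h' => h ((hmem θ).1 h')), mul_zero]

theorem integral_one_sub_mul_rpow_neg_two {t : ℝ} (h0 : 0 ≤ t) (h1 : t < 1) :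
    ∫ r in (0 : ℝ)..1, ((1 - t * r) ^ 2)⁻¹ = 1 / (1 - t) := by
  have hpos : ∀ r ∈ Set.uIcc (0 : ℝ) 1, 0 < 1 - t * r := fun r hr => by
    rw [Set.uIcc_of_le zero_le_one] at hr
    nlinarith [hr.1, hr.2]
  -- This antiderivative, unlike `1 / (t (1 - tr))`, also serves `t = 0`.
  have hd : ∀ r ∈ Set.uIcc (0 : ℝ) 1,
      HasDerivAt (fun r => r / (1 - t * r)) (((1 - t * r) ^ 2)⁻¹) r := fun r hr => by
    have hd1 : HasDerivAt (fun r : ℝ => 1 - t * r) (-t) r := by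
      simpa using ((hasDerivAt_id r).const_mul t).const_sub 1
    have := (hasDerivAt_id r).div hd1 (hpos r hr).ne'
    refine this.congr_deriv ?_
    simp only [id]
    rw [show 1 * (1 - t * r) - r * -t = 1 by ring, one_div]
  rw [intervalIntegral.integral_eq_sub_of_hasDerivAt hd]
  · simp
  · exact (ContinuousOn.inv₀ (by fun_prop)
      fun r hr => (pow_pos (hpos r hr) 2).ne').intervalIntegrable

/-- Area integrals over the disc of a radial weight against a power of `|1 - tz|`. -/
theorem lintegral_unitDisk_radial_mul_le {φ : ℝ → ℝ} (hφ : Measurable φ) {t p K : ℝ} (h0 : 0 ≤ t)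
    (h1 : t < 1) (hK0 : 0 ≤ K) (hφ0 : ∀ r ∈ Set.Ioo (0 : ℝ) 1, 0 ≤ φ r)
    (hK : ∀ r ∈ Set.Ioo (0 : ℝ) 1,
      φ r * ∫ θ in -Real.pi..Real.pi, ‖1 - circleMap 0 (t * r) θ‖ ^ (-p)
        ≤ K * ((1 - t * r) ^ 2)⁻¹) :
    ∫⁻ z in unitDisk, ENNReal.ofReal (φ ‖z‖ * ‖1 - t * z‖ ^ (-p)) ≤ ENNReal.ofReal (K / (1 - t)) := by
  have hpi := Real.pi_pos
  rw [lintegral_unitDisk_eq (by fun_prop)]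
  have hpos : ∀ r ∈ Set.Icc (0 : ℝ) 1, 0 < 1 - t * r := fun r hr => by
    nlinarith [hr.1, hr.2]
  have hi : IntervalIntegrable (fun r => K * ((1 - t * r) ^ 2)⁻¹) volume 0 1 := by
    refine (continuousOn_const.mul (ContinuousOn.inv₀ (by fun_prop)
      fun r hr => ?_)).intervalIntegrable
    rw [Set.uIcc_of_le zero_le_one] at hr
    exact (pow_pos (hpos r hr) 2).ne'
  calc _ ≤ ∫⁻ r in Set.Ioo (0 : ℝ) 1, ENNReal.ofReal (K * ((1 - t * r) ^ 2)⁻¹) := by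
        refine setLIntegral_mono' measurableSet_Ioo fun r hr => ?_
        have htr0 : 0 ≤ t * r := mul_nonneg h0 hr.1.le
        have htr1 : t * r < 1 := by nlinarith [hr.1, hr.2]
        have hc := (continuous_norm_one_sub_circleMap_rpow htr0 htr1 (-p)).const_mul (φ r)
        have e : ∫⁻ θ in Set.Ioo (-Real.pi) Real.pi,
            ENNReal.ofReal (φ ‖circleMap 0 r θ‖ * ‖1 - t * circleMap 0 r θ‖ ^ (-p))
            = ENNReal.ofReal (φ r * ∫ θ in -Real.pi..Real.pi,
                ‖1 - circleMap 0 (t * r) θ‖ ^ (-p)) := by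
          rw [← intervalIntegral.integral_const_mul,
            intervalIntegral.integral_of_le (by linarith), integral_Ioc_eq_integral_Ioo,
            ofReal_integral_eq_lintegral_ofReal]
          · refine lintegral_congr fun θ => ?_
            rw [norm_circleMap_zero, abs_of_pos hr.1]
            simp [circleMap, mul_assoc]
          · exact (hc.integrableOn_Icc).mono_set Set.Ioo_subset_Icc_self
          · exact Filter.Eventually.of_forall fun θ => mul_nonneg (hφ0 r hr) (by positivity)
        rw [e]
        -- The polar Jacobian `r` is bounded by `1`.
        calc _ ≤ 1 * ENNReal.ofReal (φ r * ∫ θ in -Real.pi..Real.pi,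
                ‖1 - circleMap 0 (t * r) θ‖ ^ (-p)) := by
              gcongr
              exact ENNReal.ofReal_le_one.2 hr.2.le
          _ ≤ _ := by
              rw [one_mul]
              exact ENNReal.ofReal_le_ofReal (hK r hr)
    _ = ENNReal.ofReal (K / (1 - t)) := by
        rw [div_eq_mul_one_div, ← integral_one_sub_mul_rpow_neg_two h0 h1,
          ← intervalIntegral.integral_const_mul, intervalIntegral.integral_of_le zero_le_one,
          integral_Ioc_eq_integral_Ioo, ofReal_integral_eq_lintegral_ofReal]
        · exact ((intervalIntegrable_iff_integrableOn_Icc_of_le zero_le_one).1 hi).mono_set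
            Set.Ioo_subset_Icc_self
        · exact Filter.Eventually.of_forall fun r => mul_nonneg hK0 (by positivity)

/-- The kernel dominating the second derivatives of `z ↦ f (t z) / (1 - t z) ^ α` for `f` in a ball
of the Bloch space. -/
noncomputable def blochKernel (t : ℝ) (z : ℂ) : ℝ :=
  ((1 - t * ‖z‖) ^ 2)⁻¹ * ‖1 - t * z‖ ^ (-1 : ℝ)
    + Real.log (Real.exp 1 / (1 - t)) * ‖1 - t * z‖ ^ (-3 : ℝ)

/-- On the circle of radius `r` both summands have integral `O(L (1 - tr)⁻²)` with `L = log (e / (1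
- t))`: in the first the logarithm comes from the mean of `|1 - tz|⁻¹`, in the second `(1 - tr)⁻²`
is the mean of `|1 - tz|⁻³`. Integrating in `r` gives `L / (1 - t)`; `1040 = 40 + 1000`. -/
theorem lintegral_blochKernel_le {t : ℝ} (h0 : 0 ≤ t) (h1 : t < 1) :
    ∫⁻ z in unitDisk, ENNReal.ofReal (blochKernel t z)
      ≤ ENNReal.ofReal (1040 * (Real.log (Real.exp 1 / (1 - t)) / (1 - t))) := by
  have hL := one_le_log_exp_one_div h0 h1
  set L := Real.log (Real.exp 1 / (1 - t)) with hLdef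
  have hr1 : ∀ r ∈ Set.Ioo (0 : ℝ) 1, 0 ≤ t * r ∧ t * r ≤ t := fun r hr =>
    ⟨mul_nonneg h0 hr.1.le, mul_le_of_le_one_right h0 hr.2.le⟩
  have A := lintegral_unitDisk_radial_mul_le (φ := fun r => ((1 - t * r) ^ 2)⁻¹) (p := 1)
    (K := 40 * L) (by fun_prop) h0 h1 (by linarith) (fun r _ => by positivity) (fun r hr => by
      obtain ⟨ha, hb⟩ := hr1 r hr
      rw [mul_comm]
      gcongr
      refine (integral_norm_one_sub_circleMap_inv_le ha (hb.trans_lt h1)).trans ?_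
      rw [hLdef, log_exp_one_div h1, log_exp_one_div (hb.trans_lt h1)]
      have := Real.log_le_log (by linarith) (show 1 - t ≤ 1 - t * r by linarith)
      linarith)
  have B := lintegral_unitDisk_radial_mul_le (φ := fun _ => L) (p := 3)
    (K := 1000 * L) (by fun_prop) h0 h1 (by linarith) (fun r _ => by linarith) (fun r hr => by
      obtain ⟨ha, hb⟩ := hr1 r hr
      have := integral_norm_one_sub_circleMap_rpow_le_of_one_lt (p := 3) ha (hb.trans_lt h1)
        (by norm_num)
      have e : (1 - t * r) ^ ((1 : ℝ) - 3) = ((1 - t * r) ^ 2)⁻¹ := by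
        rw [show (1 : ℝ) - 3 = -((2 : ℕ) : ℝ) by norm_num, Real.rpow_neg (by linarith),
          Real.rpow_natCast]
      rw [e, show (2 : ℝ) * 10 ^ (3 : ℝ) / (3 - 1) = 1000 by norm_num] at this
      rw [mul_comm 1000 L, mul_assoc]
      gcongr)
  calc ∫⁻ z in unitDisk, ENNReal.ofReal (blochKernel t z)
      = ∫⁻ z in unitDisk, (ENNReal.ofReal (((1 - t * ‖z‖) ^ 2)⁻¹ * ‖1 - t * z‖ ^ (-1 : ℝ))
          + ENNReal.ofReal (L * ‖1 - t * z‖ ^ (-3 : ℝ))) := by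
        refine lintegral_congr fun z => ?_
        rw [blochKernel, ENNReal.ofReal_add (by positivity) (by positivity)]
    _ ≤ ENNReal.ofReal (40 * L / (1 - t)) + ENNReal.ofReal (1000 * L / (1 - t)) := by
        rw [lintegral_add_left (by fun_prop)]
        exact add_le_add A B
    _ = _ := by
        have : 0 < 1 - t := by linarith
        rw [← ENNReal.ofReal_add (by positivity) (by positivity)]
        congr 1
        ring

/-! ### Taylor coefficients on the disc -/

theorem HasSum.of_eq {f g : ℕ → ℂ} {a : ℂ} (h : HasSum f a) (e : ∀ n, g n = f n) : HasSum g a :=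
  (funext e : g = f) ▸ h

theorem hasSum_taylorCoeff {f : ℂ → ℂ} (hf : DifferentiableOn ℂ f unitDisk) {z : ℂ}
    (hz : z ∈ unitDisk) : HasSum (fun n => taylorCoeff f n * z ^ n) (f z) := by
  refine HasSum.of_eq (Complex.hasSum_taylorSeries_on_ball hf hz) fun n => ?_
  simp only [taylorCoeff, sub_zero, smul_eq_mul]
  ring

theorem summable_norm_taylorCoeff_mul_pow {f : ℂ → ℂ} (hf : DifferentiableOn ℂ f unitDisk) {z : ℂ}
    (hz : z ∈ unitDisk) : Summable fun n => ‖taylorCoeff f n * z ^ n‖ :=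
  (hasSum_taylorCoeff hf hz).summable.norm

theorem taylorCoeff_deriv (f : ℂ → ℂ) (n : ℕ) :
    taylorCoeff (deriv f) n = (n + 1) * taylorCoeff f (n + 1) := by
  have h1 : (n.factorial : ℂ) ≠ 0 := by exact_mod_cast n.factorial_ne_zero
  have h2 : (n + 1 : ℂ) ≠ 0 := by exact_mod_cast n.succ_ne_zero
  rw [taylorCoeff, taylorCoeff, iteratedDeriv_succ', Nat.factorial_succ]
  push_cast
  field_simp

theorem taylorCoeff_congr {f g : ℂ → ℂ} (h : Set.EqOn f g unitDisk) (n : ℕ) :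
    taylorCoeff f n = taylorCoeff g n := by
  have : f =ᶠ[nhds 0] g := h.eventuallyEq_of_mem (Metric.isOpen_ball.mem_nhds (by simp))
  rw [taylorCoeff, taylorCoeff, this.iteratedDeriv_eq]

/-- Uniqueness of power series, the device by which coefficients are read off from an expansion
valid on the disc. -/
theorem taylorCoeff_eq_of_hasSum {f : ℂ → ℂ} {c : ℕ → ℂ}
    (h : ∀ z ∈ unitDisk, HasSum (fun n => c n * z ^ n) (f z)) (n : ℕ) :
    taylorCoeff f n = c n := by
  have hp : HasFPowerSeriesOnBall f (FormalMultilinearSeries.ofScalars ℂ c) 0 1 := by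
    refine ⟨?_, one_pos, fun {y} hy => ?_⟩
    · refine ENNReal.le_of_forall_nnreal_lt fun r hr => ?_
      refine FormalMultilinearSeries.le_radius_of_summable_norm _ ?_
      have hr' : (r : ℂ) ∈ unitDisk := by
        have : r < 1 := by exact_mod_cast hr
        simpa using this
      refine (h _ hr').summable.norm.congr fun n => ?_
      simp
    · have hy' : y ∈ unitDisk := by
        rw [← ENNReal.ofReal_one, Metric.eball_ofReal] at hy
        exact hy
      simpa [FormalMultilinearSeries.ofScalars_apply_eq, mul_comm] using h y hy'
  have ha : AnalyticAt ℂ f 0 := hp.analyticAt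
  have := congrArg (fun p => FormalMultilinearSeries.coeff p n)
    (ha.hasFPowerSeriesAt.eq_formalMultilinearSeries hp.hasFPowerSeriesAt)
  simpa [FormalMultilinearSeries.coeff_ofScalars, taylorCoeff] using this

/-! ### The function `(1 - w) ^ (-α)` -/

theorem one_sub_mem_slitPlane {w : ℂ} (hw : w ∈ unitDisk) : 1 - w ∈ Complex.slitPlane := by
  rw [sub_eq_add_neg]
  exact Complex.mem_slitPlane_of_norm_lt_one (by simpa using hw)

theorem hasDerivAt_one_sub_cpow (β : ℂ) {w : ℂ} (hw : w ∈ unitDisk) :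
    HasDerivAt (fun w => (1 - w) ^ (-β)) (β * (1 - w) ^ (-(β + 1))) w := by
  have := ((hasDerivAt_id w).const_sub 1).cpow_const (c := -β) (one_sub_mem_slitPlane hw)
  refine this.congr_deriv ?_
  rw [show -β - 1 = -(β + 1) by ring]
  simp

theorem differentiableOn_one_sub_cpow (β : ℂ) :
    DifferentiableOn ℂ (fun w => (1 - w) ^ (-β)) unitDisk := fun _ hw =>
  (hasDerivAt_one_sub_cpow β hw).differentiableAt.differentiableWithinAt

theorem norm_one_sub_cpow (β : ℝ) (w : ℂ) :
    ‖(1 - w) ^ (-(β : ℂ))‖ = ‖1 - w‖ ^ (-β) := by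
  rw [← Complex.ofReal_neg, Complex.norm_cpow_real]

theorem taylorCoeff_const_mul (c : ℂ) {f : ℂ → ℂ} (hf : DifferentiableOn ℂ f unitDisk) (n : ℕ) :
    taylorCoeff (fun w => c * f w) n = c * taylorCoeff f n :=
  taylorCoeff_eq_of_hasSum (f := fun w => c * f w) (c := fun n => c * taylorCoeff f n)
    (fun _ hz => HasSum.of_eq ((hasSum_taylorCoeff hf hz).mul_left c) fun _ => mul_assoc _ _ _) n

/-- Induction on `m` with `α` varying: the derivative of `(1 - w)^(-α)` is `α (1 - w)^(-(α+1))`, so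
coefficient `m + 1` at `α` comes from coefficient `m` at `α + 1`. -/
theorem taylorCoeff_one_sub_cpow {α : ℝ} (hα : 0 < α) (m : ℕ) :
    taylorCoeff (fun w => (1 - w) ^ (-(α : ℂ))) m = gammaCoeff α m := by
  induction m generalizing α with
  | zero =>
    have := (Real.Gamma_pos_of_pos hα).ne'
    simp [taylorCoeff, gammaCoeff, this]
  | succ m ih =>
    have h := taylorCoeff_deriv (fun w => (1 - w) ^ (-(α : ℂ))) m
    rw [taylorCoeff_congr (g := fun w => (α : ℂ) * (1 - w) ^ (-((α + 1 : ℝ) : ℂ)))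
      (fun w hw => by
        rw [(hasDerivAt_one_sub_cpow α hw).deriv]; push_cast; rfl),
      taylorCoeff_const_mul _ (differentiableOn_one_sub_cpow _), ih (by linarith)] at h
    have h2 : (m + 1 : ℂ) ≠ 0 := by exact_mod_cast m.succ_ne_zero
    refine mul_left_cancel₀ h2 (h.symm.trans ?_)
    norm_cast
    have h3 := (Real.Gamma_pos_of_pos hα).ne'
    have h4 : (m.factorial : ℝ) ≠ 0 := by exact_mod_cast m.factorial_ne_zero
    rw [gammaCoeff, gammaCoeff, Real.Gamma_add_one hα.ne', Nat.factorial_succ]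
    push_cast
    rw [show (m : ℝ) + (α + 1) = m + 1 + α by ring]
    field_simp

/-- The function `f(w) / (1 - w) ^ α`. -/
noncomputable def cesaroIntegrand (α : ℝ) (f : ℂ → ℂ) (w : ℂ) : ℂ := f w * (1 - w) ^ (-(α : ℂ))

theorem differentiableOn_cesaroIntegrand (α : ℝ) {f : ℂ → ℂ} (hf : DifferentiableOn ℂ f unitDisk) :
    DifferentiableOn ℂ (cesaroIntegrand α f) unitDisk :=
  hf.mul (differentiableOn_one_sub_cpow α)

theorem taylorCoeff_cesaroIntegrand {α : ℝ} (hα : 0 < α) {f : ℂ → ℂ}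
    (hf : DifferentiableOn ℂ f unitDisk) (n : ℕ) :
    taylorCoeff (cesaroIntegrand α f) n
      = ∑ k ∈ Finset.range (n + 1), (gammaCoeff α (n - k) : ℂ) * taylorCoeff f k := by
  refine taylorCoeff_eq_of_hasSum (c := fun n => ∑ k ∈ Finset.range (n + 1),
    (gammaCoeff α (n - k) : ℂ) * taylorCoeff f k) (fun z hz => ?_) n
  have hq := differentiableOn_one_sub_cpow (α : ℂ)
  have := hasSum_sum_range_mul_of_summable_norm (summable_norm_taylorCoeff_mul_pow hf hz)
    (summable_norm_taylorCoeff_mul_pow hq hz)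
  rw [(hasSum_taylorCoeff hf hz).tsum_eq, (hasSum_taylorCoeff hq hz).tsum_eq] at this
  refine HasSum.of_eq this fun n => ?_
  rw [Finset.sum_mul]
  refine Finset.sum_congr rfl fun k hk => ?_
  have hk' : k + (n - k) = n := by
    have := Finset.mem_range.1 hk
    omega
  rw [taylorCoeff_one_sub_cpow hα]
  nth_rw 2 [← hk']
  rw [pow_add]
  ring

/-! ### Integral representation of the operator -/

/-- Termwise integration of `t^j g(tz)`, dominated by `∑ |g_n z^n|` since `0 ≤ t < 1`. The factor
`t^j` shifts the moments: `j = 0` represents the operator, `j = 2` its second derivative. -/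
theorem hasSum_moment_mul_taylorCoeff (μ : Measure (Set.Ico (0 : ℝ) 1)) [IsFiniteMeasure μ]
    {g : ℂ → ℂ} (hg : DifferentiableOn ℂ g unitDisk) (j : ℕ) {z : ℂ} (hz : z ∈ unitDisk) :
    HasSum (fun n => (moment μ (n + j) : ℂ) * taylorCoeff g n * z ^ n)
      (∫ t, ((t : ℝ) : ℂ) ^ j * g ((t : ℝ) * z) ∂μ) := by
  have hbd : ∀ n, ∀ t : Set.Ico (0 : ℝ) 1,
      ‖((t : ℝ) : ℂ) ^ j * (taylorCoeff g n * ((t : ℝ) * z) ^ n)‖ ≤ ‖taylorCoeff g n * z ^ n‖ := by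
    intro n t
    rw [mul_pow, norm_mul, norm_mul, norm_mul, norm_mul, norm_pow, norm_pow, Complex.norm_real,
      Real.norm_of_nonneg t.2.1]
    have h1 := pow_le_one₀ (n := n) t.2.1 t.2.2.le
    have h2 := pow_le_one₀ (n := j) t.2.1 t.2.2.le
    have h3 : 0 ≤ (t : ℝ) ^ n := pow_nonneg t.2.1 n
    calc (t : ℝ) ^ j * (‖taylorCoeff g n‖ * ((t : ℝ) ^ n * ‖z ^ n‖))
        ≤ 1 * (‖taylorCoeff g n‖ * (1 * ‖z ^ n‖)) := by gcongr
      _ = _ := by ring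
  have hmeas : ∀ n, AEStronglyMeasurable (fun t : Set.Ico (0 : ℝ) 1 =>
      ((t : ℝ) : ℂ) ^ j * (taylorCoeff g n * ((t : ℝ) * z) ^ n)) μ := fun n =>
    Continuous.aestronglyMeasurable (by fun_prop)
  have hint : ∀ n, Integrable (fun t : Set.Ico (0 : ℝ) 1 =>
      ((t : ℝ) : ℂ) ^ j * (taylorCoeff g n * ((t : ℝ) * z) ^ n)) μ := fun n =>
    (integrable_const (‖taylorCoeff g n * z ^ n‖)).mono' (hmeas n)
      (Filter.Eventually.of_forall (hbd n))
  have hs := hasSum_integral_of_summable_integral_norm hint (by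
    refine Summable.of_nonneg_of_le (fun n => integral_nonneg fun t => norm_nonneg _) (fun n => ?_)
      ((summable_norm_taylorCoeff_mul_pow hg hz).mul_left (μ.real Set.univ))
    refine (integral_mono (hint n).norm (integrable_const _) (hbd n)).trans_eq ?_
    rw [integral_const, smul_eq_mul])
  have e : ∀ t : Set.Ico (0 : ℝ) 1,
      ∑' n, ((t : ℝ) : ℂ) ^ j * (taylorCoeff g n * ((t : ℝ) * z) ^ n)
        = ((t : ℝ) : ℂ) ^ j * g ((t : ℝ) * z) := fun t => by
    rw [tsum_mul_left, (hasSum_taylorCoeff hg (z := (t : ℝ) * z) _).tsum_eq]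
    rw [mem_ball_zero_iff] at hz ⊢
    rw [norm_mul, Complex.norm_real, Real.norm_of_nonneg t.2.1]
    exact (mul_le_of_le_one_left (norm_nonneg z) t.2.2.le).trans_lt hz
  simp_rw [e] at hs
  refine HasSum.of_eq hs fun n => ?_
  have : ∀ t : Set.Ico (0 : ℝ) 1, ((t : ℝ) : ℂ) ^ j * (taylorCoeff g n * ((t : ℝ) * z) ^ n)
      = (((t : ℝ) ^ (n + j) : ℝ) : ℂ) * (taylorCoeff g n * z ^ n) := fun t => by
    push_cast; ring
  simp_rw [this]
  rw [integral_mul_const, integral_complex_ofReal, moment]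
  ring

theorem cesaroOp_apply (μ : Measure (Set.Ico (0 : ℝ) 1)) [IsFiniteMeasure μ] {α : ℝ} (hα : 0 < α)
    (f : HolDisk) {z : ℂ} (hz : z ∈ unitDisk) :
    HasSum (fun n => cesaroCoeff μ α f n * z ^ n) ((cesaroOp μ α hα f : ℂ → ℂ) z) := by
  have : (cesaroOp μ α hα f : ℂ → ℂ) z = ∑' n, cesaroCoeff μ α f n * z ^ n := if_pos hz
  rw [this]
  exact (summable_cesaro_apply μ hα f hz).hasSum

theorem taylorCoeff_cesaroOp (μ : Measure (Set.Ico (0 : ℝ) 1)) [IsFiniteMeasure μ] {α : ℝ}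
    (hα : 0 < α) (f : HolDisk) (n : ℕ) :
    taylorCoeff (cesaroOp μ α hα f : ℂ → ℂ) n = cesaroCoeff μ α f n :=
  taylorCoeff_eq_of_hasSum (fun _ hz => cesaroOp_apply μ hα f hz) n

theorem cesaroCoeff_eq (μ : Measure (Set.Ico (0 : ℝ) 1)) {α : ℝ} (hα : 0 < α) (f : HolDisk)
    (n : ℕ) :
    cesaroCoeff μ α f n = moment μ n * taylorCoeff (cesaroIntegrand α f) n := by
  rw [cesaroCoeff, taylorCoeff_cesaroIntegrand hα f.2.1]

theorem cesaroOp_eq_integral (μ : Measure (Set.Ico (0 : ℝ) 1)) [IsFiniteMeasure μ] {α : ℝ}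
    (hα : 0 < α) (f : HolDisk) {z : ℂ} (hz : z ∈ unitDisk) :
    (cesaroOp μ α hα f : ℂ → ℂ) z = ∫ t, cesaroIntegrand α f ((t : ℝ) * z) ∂μ := by
  have h := hasSum_moment_mul_taylorCoeff μ (differentiableOn_cesaroIntegrand α f.2.1) 0 hz
  simp only [pow_zero, one_mul, add_zero] at h
  refine (cesaroOp_apply μ hα f hz).unique (HasSum.of_eq h fun n => ?_)
  rw [cesaroCoeff_eq μ hα]

theorem hasSum_deriv2 {F : ℂ → ℂ} (hF : DifferentiableOn ℂ F unitDisk) {z : ℂ}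
    (hz : z ∈ unitDisk) :
    HasSum (fun n : ℕ => ((n : ℂ) + 1) * ((n + 2) * taylorCoeff F (n + 2)) * z ^ n)
      (deriv (deriv F) z) := by
  have hd := (hF.deriv Metric.isOpen_ball).deriv Metric.isOpen_ball
  refine HasSum.of_eq (hasSum_taylorCoeff hd hz) fun n => ?_
  rw [taylorCoeff_deriv, taylorCoeff_deriv]
  push_cast
  ring

/-- Comparing power series replaces differentiation under the integral: the chain-rule factor `t²`
matches the index shift in `μ_{n+2}`. -/
theorem deriv2_cesaroOp_eq_integral (μ : Measure (Set.Ico (0 : ℝ) 1)) [IsFiniteMeasure μ] {α : ℝ}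
    (hα : 0 < α) (f : HolDisk) {z : ℂ} (hz : z ∈ unitDisk) :
    deriv (deriv (cesaroOp μ α hα f : ℂ → ℂ)) z
      = ∫ t, ((t : ℝ) : ℂ) ^ 2 * deriv (deriv (cesaroIntegrand α f)) ((t : ℝ) * z) ∂μ := by
  have hd := ((differentiableOn_cesaroIntegrand α f.2.1).deriv Metric.isOpen_ball).deriv
    Metric.isOpen_ball
  refine (hasSum_deriv2 (cesaroOp μ α hα f).2.1 hz).unique
    (HasSum.of_eq (hasSum_moment_mul_taylorCoeff μ hd 2 hz) fun n => ?_)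
  rw [taylorCoeff_deriv, taylorCoeff_deriv, taylorCoeff_cesaroOp, cesaroCoeff_eq μ hα]
  push_cast
  ring

/-! ### Growth estimates for Bloch functions -/

section

/-- The functions `f ∈ H(𝔻)` with `|f(0)| ≤ M` and `(1 - |z|²) |f'(z)| ≤ M` on the disc. -/
def blochBall (M : ℝ) : Set HolDisk :=
  {f | ‖(f : ℂ → ℂ) 0‖ ≤ M ∧ ∀ z ∈ unitDisk, (1 - ‖z‖ ^ 2) * ‖deriv (f : ℂ → ℂ) z‖ ≤ M}

variable {M : ℝ} {f : HolDisk}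

theorem nonneg_of_mem_blochBall (hf : f ∈ blochBall M) : 0 ≤ M := (norm_nonneg _).trans hf.1

theorem norm_deriv_le_of_mem_blochBall (hf : f ∈ blochBall M) {z : ℂ} (hz : z ∈ unitDisk) :
    ‖deriv (f : ℂ → ℂ) z‖ ≤ M / (1 - ‖z‖) := by
  have hz' : ‖z‖ < 1 := by simpa using hz
  rw [le_div_iff₀ (by linarith)]
  refine (hf.2 z hz).trans' ?_
  rw [mul_comm]
  gcongr
  nlinarith [norm_nonneg z]

/-- Cauchy's estimate for `f'` on the disc of radius `(1 - |z|)/2` about `z`, where the distance to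
the unit circle is still at least `(1 - |z|)/2`. -/
theorem norm_deriv2_le_of_mem_blochBall (hf : f ∈ blochBall M) {z : ℂ} (hz : z ∈ unitDisk) :
    ‖deriv (deriv (f : ℂ → ℂ)) z‖ ≤ 4 * M / (1 - ‖z‖) ^ 2 := by
  have hz' : ‖z‖ < 1 := by simpa using hz
  have hM := nonneg_of_mem_blochBall hf
  have hR : 0 < (1 - ‖z‖) / 2 := by linarith
  have hsub : Metric.closedBall z ((1 - ‖z‖) / 2) ⊆ unitDisk := fun w hw => by
    rw [mem_closedBall_iff_norm] at hw
    rw [mem_ball_zero_iff]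
    have := norm_le_norm_add_norm_sub' w z
    linarith
  have hd : DiffContOnCl ℂ (deriv (f : ℂ → ℂ)) (Metric.ball z ((1 - ‖z‖) / 2)) :=
    ((f.2.1.deriv Metric.isOpen_ball).mono
      (Metric.closure_ball_subset_closedBall.trans hsub)).diffContOnCl
  refine (Complex.norm_deriv_le_of_forall_mem_sphere_norm_le
    (C := M / ((1 - ‖z‖) / 2)) hR hd fun w hw => ?_).trans_eq ?_
  · have hw' := hsub (Metric.sphere_subset_closedBall hw)
    refine (norm_deriv_le_of_mem_blochBall hf hw').trans ?_
    rw [mem_sphere_iff_norm] at hw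
    have := norm_le_norm_add_norm_sub' w z
    gcongr
    linarith
  · field_simp
    ring

theorem norm_le_of_mem_blochBall (hf : f ∈ blochBall M) {z : ℂ} (hz : z ∈ unitDisk) :
    ‖(f : ℂ → ℂ) z‖ ≤ M * Real.log (Real.exp 1 / (1 - ‖z‖)) := by
  have hz' : ‖z‖ < 1 := by simpa using hz
  have hM := nonneg_of_mem_blochBall hf
  have hnorm : ∀ s ∈ Set.Icc (0 : ℝ) 1, ‖(s : ℂ) * z‖ = s * ‖z‖ := fun s hs => by
    rw [norm_mul, Complex.norm_real, Real.norm_of_nonneg hs.1]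
  have hlt : ∀ s ∈ Set.Icc (0 : ℝ) 1, s * ‖z‖ < 1 := fun s hs =>
    (mul_le_of_le_one_left (norm_nonneg z) hs.2).trans_lt hz'
  have hmem : ∀ s ∈ Set.Icc (0 : ℝ) 1, (s : ℂ) * z ∈ unitDisk := fun s hs => by
    rw [mem_ball_zero_iff, hnorm s hs]
    exact hlt s hs
  have hd : ∀ s ∈ Set.Icc (0 : ℝ) 1, HasDerivAt (fun s : ℝ => (f : ℂ → ℂ) ((s : ℂ) * z))
      (deriv (f : ℂ → ℂ) ((s : ℂ) * z) * z) s := fun s hs => by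
    have h1 : HasDerivAt (fun s : ℝ => (s : ℂ) * z) z s := by
      simpa using (Complex.ofRealCLM.hasDerivAt (x := s)).mul_const z
    exact (HolDisk.analyticOnNhd f _ (hmem s hs)).differentiableAt.hasDerivAt.comp_of_eq s h1 rfl
  have hB : ∀ s ∈ Set.Icc (0 : ℝ) 1, HasDerivAt (fun s : ℝ => M * (1 - Real.log (1 - s * ‖z‖)))
      (M * (‖z‖ / (1 - s * ‖z‖))) s := fun s hs => by
    have h1 : HasDerivAt (fun s : ℝ => 1 - s * ‖z‖) (-‖z‖) s := by
      simpa using ((hasDerivAt_id s).mul_const ‖z‖).const_sub 1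
    have := ((h1.log (by linarith [hlt s hs])).const_sub 1).const_mul M
    refine this.congr_deriv ?_
    ring
  -- Integration of the bound for `f'` along the segment from `0` to `z`; the barrier starts at `M`,
  -- which dominates `|f(0)|`.
  have key := image_norm_le_of_norm_deriv_right_le_deriv_boundary' (a := 0) (b := 1)
    (f := fun s : ℝ => (f : ℂ → ℂ) ((s : ℂ) * z))
    (f' := fun s : ℝ => deriv (f : ℂ → ℂ) ((s : ℂ) * z) * z)
    (B := fun s : ℝ => M * (1 - Real.log (1 - s * ‖z‖)))
    (B' := fun s : ℝ => M * (‖z‖ / (1 - s * ‖z‖)))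
    (fun s hs => (hd s hs).continuousAt.continuousWithinAt)
    (fun s hs => (hd s (Set.Ico_subset_Icc_self hs)).hasDerivWithinAt)
    (by simpa using hf.1)
    (fun s hs => (hB s hs).continuousAt.continuousWithinAt)
    (fun s hs => (hB s (Set.Ico_subset_Icc_self hs)).hasDerivWithinAt)
    (fun s hs => by
      have hs' := Set.Ico_subset_Icc_self hs
      have := norm_deriv_le_of_mem_blochBall hf (hmem s hs')
      rw [hnorm s hs'] at this
      rw [norm_mul]
      refine (mul_le_mul_of_nonneg_right this (norm_nonneg z)).trans_eq ?_
      ring)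
    (x := 1) (by simp)
  rw [log_exp_one_div hz']
  simpa using key

theorem norm_taylorCoeff_succ_le_of_mem_blochBall (hf : f ∈ blochBall M) (n : ℕ) :
    ‖taylorCoeff (f : ℂ → ℂ) (n + 1)‖ ≤ 6 * M := by
  have hM := nonneg_of_mem_blochBall hf
  have hn : (0 : ℝ) < n + 2 := by positivity
  -- At this radius `1 - ρ = 1/(n+2)` while `ρ⁻ⁿ ≤ e ≤ 3`. Cauchy's estimate for `f'` then gives
  -- `(n+1) |a_{n+1}| ≤ 3M (n+2) ≤ 6M (n+1)`.
  set ρ : ℝ := (n + 1) / (n + 2) with hρ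
  have hρ0 : 0 < ρ := by positivity
  have hρ1 : 1 - ρ = 1 / (n + 2) := by rw [hρ]; field_simp; ring
  have hρlt : ρ < 1 := by
    have : 0 < 1 / ((n : ℝ) + 2) := by positivity
    linarith
  have hd : DiffContOnCl ℂ (deriv (f : ℂ → ℂ)) (Metric.ball 0 ρ) := by
    refine ((f.2.1.deriv Metric.isOpen_ball).mono
      (Metric.closure_ball_subset_closedBall.trans ?_)).diffContOnCl
    exact Metric.closedBall_subset_ball hρlt
  have h := Complex.norm_iteratedDeriv_le_of_forall_mem_sphere_norm_le n (C := M * (n + 2)) hρ0 hd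
    fun w hw => by
      have hw' : ‖w‖ = ρ := by simpa using hw
      refine (norm_deriv_le_of_mem_blochBall hf (by simpa [hw'] using hρlt)).trans_eq ?_
      rw [hw', hρ1, one_div, div_inv_eq_mul]
  have h2 : ‖taylorCoeff (deriv (f : ℂ → ℂ)) n‖ ≤ M * (n + 2) / ρ ^ n := by
    have hfac : (0 : ℝ) < n.factorial := by exact_mod_cast n.factorial_pos
    rw [taylorCoeff, norm_div, Complex.norm_natCast, div_le_iff₀ hfac]
    refine h.trans_eq ?_
    ring
  have h3 : (1 / ρ) ^ n ≤ 3 := by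
    have e1 : 1 / ρ = 1 / ((n : ℝ) + 1) + 1 := by rw [hρ]; field_simp; ring
    calc (1 / ρ) ^ n ≤ Real.exp (1 / ((n : ℝ) + 1)) ^ n := by
          rw [e1]
          gcongr
          exact Real.add_one_le_exp _
      _ = Real.exp (n * (1 / ((n : ℝ) + 1))) := (Real.exp_nat_mul _ n).symm
      _ ≤ Real.exp 1 := by
          gcongr
          rw [mul_one_div, div_le_one (by positivity)]
          linarith
      _ ≤ 3 := by linarith [Real.exp_one_lt_d9]
  rw [taylorCoeff_deriv, norm_mul] at h2
  have e2 : ‖(n : ℂ) + 1‖ = n + 1 := by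
    rw [← Nat.cast_succ, Complex.norm_natCast, Nat.cast_succ]
  rw [e2, div_eq_mul_one_div, ← one_div_pow] at h2
  have h4 : M * (n + 2) * (1 / ρ) ^ n ≤ M * (n + 2) * 3 := by gcongr
  have h5 : (0 : ℝ) < n + 1 := by positivity
  have h6 : (n + 1) * ‖taylorCoeff (f : ℂ → ℂ) (n + 1)‖ ≤ (n + 1) * (6 * M) := by
    have : (0 : ℝ) ≤ n := n.cast_nonneg
    nlinarith
  exact le_of_mul_le_mul_left h6 h5

theorem norm_taylorCoeff_le_of_mem_blochBall (hf : f ∈ blochBall M) (n : ℕ) :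
    ‖taylorCoeff (f : ℂ → ℂ) n‖ ≤ 6 * M := by
  cases n with
  | zero =>
    have := nonneg_of_mem_blochBall hf
    have h := hf.1
    simp only [taylorCoeff, iteratedDeriv_zero, Nat.factorial_zero, Nat.cast_one, div_one]
    linarith
  | succ n => exact norm_taylorCoeff_succ_le_of_mem_blochBall hf n

theorem hasDerivAt_cesaroIntegrand (α : ℝ) {f f' : ℂ → ℂ} {w : ℂ} (hw : w ∈ unitDisk)
    (hf : HasDerivAt f (f' w) w) :
    HasDerivAt (cesaroIntegrand α f)
      (cesaroIntegrand α f' w + α * cesaroIntegrand (α + 1) f w) w := by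
  refine (hf.mul (hasDerivAt_one_sub_cpow (α : ℂ) hw)).congr_deriv ?_
  simp only [cesaroIntegrand]
  push_cast
  ring

theorem deriv2_cesaroIntegrand (α : ℝ) {f : ℂ → ℂ} (hf : DifferentiableOn ℂ f unitDisk) {w : ℂ}
    (hw : w ∈ unitDisk) :
    deriv (deriv (cesaroIntegrand α f)) w = cesaroIntegrand α (deriv (deriv f)) w
      + 2 * α * cesaroIntegrand (α + 1) (deriv f) w
      + α * (α + 1) * cesaroIntegrand (α + 2) f w := by
  have hf0 : ∀ z ∈ unitDisk, HasDerivAt f (deriv f z) z := fun z hz =>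
    (hf.differentiableAt (Metric.isOpen_ball.mem_nhds hz)).hasDerivAt
  have hf1 : HasDerivAt (deriv f) (deriv (deriv f) w) w :=
    ((hf.deriv Metric.isOpen_ball).differentiableAt (Metric.isOpen_ball.mem_nhds hw)).hasDerivAt
  have h : deriv (cesaroIntegrand α f) =ᶠ[nhds w]
      fun z => cesaroIntegrand α (deriv f) z + α * cesaroIntegrand (α + 1) f z := by
    filter_upwards [Metric.isOpen_ball.mem_nhds hw] with z hz
    exact (hasDerivAt_cesaroIntegrand α hz (hf0 z hz)).deriv
  have h2 : HasDerivAt (fun z => cesaroIntegrand α (deriv f) z + α * cesaroIntegrand (α + 1) f z)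
      _ w := (hasDerivAt_cesaroIntegrand α hw hf1).add
    ((hasDerivAt_cesaroIntegrand (α + 1) hw (hf0 w hw)).const_mul (α : ℂ))
  rw [h.deriv_eq, h2.deriv, show α + 1 + 1 = α + 2 by ring]
  push_cast
  ring

theorem norm_cesaroIntegrand (α : ℝ) (f : ℂ → ℂ) (w : ℂ) :
    ‖cesaroIntegrand α f w‖ = ‖f w‖ * ‖1 - w‖ ^ (-α) := by
  rw [cesaroIntegrand, norm_mul, norm_one_sub_cpow]

/-- Leibniz produces `f''`, `f'`, `f` against `|1 - tz|` to the powers `-α`, `-α-1`, `-α-2`.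
Splitting off `(1 - t)^(1 - α)` removes `α` from the exponents; the `f''` and `f'` terms go into the
first summand of the kernel, the `f` term into the second. -/
theorem norm_deriv2_cesaroIntegrand_le {α : ℝ} (hα : 1 ≤ α) (hf : f ∈ blochBall M) {t : ℝ}
    (h0 : 0 ≤ t) (h1 : t < 1) {z : ℂ} (hz : z ∈ unitDisk) :
    ‖deriv (deriv (cesaroIntegrand α f)) (t * z)‖
      ≤ 8 * (α + 1) ^ 2 * M * ((1 - t) ^ (1 - α) * blochKernel t z) := by
  have hM := nonneg_of_mem_blochBall hf
  have hz' : ‖z‖ < 1 := by simpa using hz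
  have hn : ‖(t : ℂ) * z‖ = t * ‖z‖ := by rw [norm_mul, Complex.norm_real, Real.norm_of_nonneg h0]
  have hn0 : 0 ≤ t * ‖z‖ := by positivity
  have hnt : t * ‖z‖ ≤ t := mul_le_of_le_one_right h0 hz'.le
  have hw : (t : ℂ) * z ∈ unitDisk := by rw [mem_ball_zero_iff, hn]; linarith
  have hge : 1 - t * ‖z‖ ≤ ‖1 - (t : ℂ) * z‖ := by
    have := norm_sub_norm_le (1 : ℂ) (t * z)
    rwa [norm_one, hn] at this
  set a := 1 - t * ‖z‖ with ha
  set b := ‖1 - (t : ℂ) * z‖ with hb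
  have ha0 : 0 < a := by linarith
  have hb0 : 0 < b := by linarith
  have hL := one_le_log_exp_one_div h0 h1
  set L := Real.log (Real.exp 1 / (1 - t)) with hLdef
  -- The exponent is nonpositive because `α ≥ 1`, and `b ≥ a ≥ 1 - t`.
  have hbt : b ^ (1 - α) ≤ (1 - t) ^ (1 - α) :=
    Real.rpow_le_rpow_of_nonpos (by linarith) (by linarith) (by linarith)
  have hpow : ∀ k : ℕ, b ^ (-(α + k)) ≤ (1 - t) ^ (1 - α) * (b ^ (k + 1))⁻¹ := fun k => by
    rw [show -(α + k) = (1 - α) + -((k + 1 : ℕ) : ℝ) by push_cast; ring, Real.rpow_add hb0,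
      Real.rpow_neg hb0.le, Real.rpow_natCast]
    gcongr
  have hf0 := norm_le_of_mem_blochBall hf hw
  have hf1 := norm_deriv_le_of_mem_blochBall hf hw
  have hf2 := norm_deriv2_le_of_mem_blochBall hf hw
  rw [hn] at hf0 hf1 hf2
  have hlog : Real.log (Real.exp 1 / (1 - t * ‖z‖)) ≤ L := by
    rw [hLdef, log_exp_one_div h1, log_exp_one_div (by linarith)]
    have := Real.log_le_log (by linarith) (show 1 - t ≤ 1 - t * ‖z‖ by linarith)
    linarith
  have hf0' := hf0.trans (mul_le_mul_of_nonneg_left hlog hM)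
  set P := (1 - t) ^ (1 - α) with hP
  have hP0 : 0 ≤ P := Real.rpow_nonneg (by linarith) _
  set U := (a ^ 2)⁻¹ * b⁻¹ with hU
  set V := L * (b ^ 3)⁻¹ with hV
  have hU0 : 0 ≤ U := by positivity
  have hV0 : 0 ≤ V := by positivity
  have hk : blochKernel t z = U + V := by
    rw [blochKernel, Real.rpow_neg_one, ← ha, ← hb, ← hLdef,
      show (-3 : ℝ) = -((3 : ℕ) : ℝ) by norm_num, Real.rpow_neg hb0.le, Real.rpow_natCast]
  have t1 : ‖cesaroIntegrand α (deriv (deriv (f : ℂ → ℂ))) (t * z)‖ ≤ 4 * M * P * U := by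
    rw [norm_cesaroIntegrand]
    have := hpow 0
    rw [Nat.cast_zero, add_zero, zero_add, pow_one] at this
    refine (mul_le_mul hf2 this (by positivity) (by positivity)).trans_eq ?_
    rw [hU]; ring
  have t2 : ‖cesaroIntegrand (α + 1) (deriv (f : ℂ → ℂ)) (t * z)‖ ≤ M * P * U := by
    rw [norm_cesaroIntegrand]
    have := hpow 1
    rw [Nat.cast_one] at this
    refine (mul_le_mul hf1 this (by positivity) (by positivity)).trans ?_
    -- One factor `b⁻¹` is traded for `a⁻¹`, as `a ≤ b`.
    have : a⁻¹ * (b ^ 2)⁻¹ ≤ U := by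
      rw [hU, ← mul_inv, ← mul_inv]
      refine inv_anti₀ (by positivity) ?_
      nlinarith [mul_pos ha0 hb0]
    calc M / a * (P * (b ^ (1 + 1))⁻¹) = M * P * (a⁻¹ * (b ^ 2)⁻¹) := by ring
      _ ≤ M * P * U := by gcongr
  have t3 : ‖cesaroIntegrand (α + 2) f (t * z)‖ ≤ M * P * V := by
    rw [norm_cesaroIntegrand]
    have := hpow 2
    rw [Nat.cast_ofNat] at this
    refine (mul_le_mul hf0' this (by positivity) (by positivity)).trans_eq ?_
    rw [hV]; ring
  have c1 : ‖2 * (α : ℂ)‖ = 2 * α := by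
    rw [norm_mul, Complex.norm_real, Real.norm_of_nonneg (by linarith), Complex.norm_ofNat]
  have c2 : ‖(α : ℂ) * (α + 1)‖ = α * (α + 1) := by
    rw [← Complex.ofReal_one, ← Complex.ofReal_add, ← Complex.ofReal_mul, Complex.norm_real,
      Real.norm_of_nonneg (by positivity)]
  rw [deriv2_cesaroIntegrand α f.2.1 hw, hk]
  refine (norm_add₃_le).trans ?_
  rw [norm_mul, norm_mul ((α : ℂ) * (α + 1)), c1, c2]
  have s2 := mul_le_mul_of_nonneg_left t2 (show 0 ≤ 2 * α by linarith)
  have s3 := mul_le_mul_of_nonneg_left t3 (show 0 ≤ α * (α + 1) by positivity)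
  have hU' : 0 ≤ M * P * U := by positivity
  have hV' : 0 ≤ M * P * V := by positivity
  -- `8 (α + 1)²` is a crude common bound for `4 + 2α` and `α (α + 1)`.
  have q1 : (4 + 2 * α) * (M * P * U) ≤ 8 * (α + 1) ^ 2 * (M * P * U) :=
    mul_le_mul_of_nonneg_right (by nlinarith) hU'
  have q2 : α * (α + 1) * (M * P * V) ≤ 8 * (α + 1) ^ 2 * (M * P * V) :=
    mul_le_mul_of_nonneg_right (by nlinarith) hV'
  linarith

end

/-! ### The integrable majorant and membership in `B_1` -/

theorem measurable_weighted_blochKernel (α : ℝ) : Measurable fun p : ℂ × Set.Ico (0 : ℝ) 1 =>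
    ENNReal.ofReal ((1 - (p.2 : ℝ)) ^ (1 - α) * blochKernel p.2 p.1) := by
  have h2 : Measurable fun p : ℂ × Set.Ico (0 : ℝ) 1 => (p.2 : ℝ) :=
    measurable_subtype_coe.comp measurable_snd
  have h2' : Measurable fun p : ℂ × Set.Ico (0 : ℝ) 1 => ((p.2 : ℝ) : ℂ) :=
    Complex.measurable_ofReal.comp h2
  unfold blochKernel
  fun_prop

/-- The majorant of `|F''|` on the disc for the images `F` of a ball of the Bloch space. -/
noncomputable def blochMajorant (μ : Measure (Set.Ico (0 : ℝ) 1)) (α : ℝ) (z : ℂ) : ENNReal :=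
  ∫⁻ t, ENNReal.ofReal ((1 - (t : ℝ)) ^ (1 - α) * blochKernel t z) ∂μ

theorem measurable_blochMajorant (μ : Measure (Set.Ico (0 : ℝ) 1)) [IsFiniteMeasure μ] (α : ℝ) :
    Measurable (blochMajorant μ α) :=
  (measurable_weighted_blochKernel α).lintegral_prod_right'

/-- Tonelli: the area integral of the kernel costs `log (e / (1 - t)) / (1 - t)`, and the weight `(1
- t)^(1 - α)` turns this into the integrand of condition 4. -/
theorem lintegral_blochMajorant_lt_top (μ : Measure (Set.Ico (0 : ℝ) 1)) [IsFiniteMeasure μ] (α : ℝ)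
    (hμ : ∫⁻ t, ENNReal.ofReal
      (Real.log (Real.exp 1 / (1 - (t : ℝ))) / (1 - (t : ℝ)) ^ α) ∂μ < ⊤) :
    ∫⁻ z in unitDisk, blochMajorant μ α z < ⊤ := by
  unfold blochMajorant
  rw [lintegral_lintegral_swap (measurable_weighted_blochKernel α).aemeasurable]
  refine (lintegral_mono (g := fun t : Set.Ico (0 : ℝ) 1 => ENNReal.ofReal 1040 * ENNReal.ofReal
      (Real.log (Real.exp 1 / (1 - (t : ℝ))) / (1 - (t : ℝ)) ^ α)) fun t => ?_).trans_lt ?_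
  · have ht : 0 < 1 - (t : ℝ) := by linarith [t.2.2]
    have hw : 0 ≤ (1 - (t : ℝ)) ^ (1 - α) := Real.rpow_nonneg ht.le _
    simp_rw [ENNReal.ofReal_mul hw]
    rw [lintegral_const_mul' _ _ ENNReal.ofReal_ne_top]
    refine (mul_le_mul_right (lintegral_blochKernel_le t.2.1 t.2.2) _).trans_eq ?_
    rw [← ENNReal.ofReal_mul hw, ← ENNReal.ofReal_mul (by norm_num)]
    congr 1
    rw [Real.rpow_sub ht, Real.rpow_one]
    field_simp
  · rw [lintegral_const_mul' _ _ ENNReal.ofReal_ne_top]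
    exact ENNReal.mul_lt_top ENNReal.ofReal_lt_top hμ

/-- The bound depends on `f` only through `M`; this uniformity drives the compactness argument. -/
theorem enorm_deriv2_cesaroOp_le (μ : Measure (Set.Ico (0 : ℝ) 1)) [IsFiniteMeasure μ] {α : ℝ}
    (hα : 1 ≤ α) {M : ℝ} {f : HolDisk} (hf : f ∈ blochBall M) {z : ℂ} (hz : z ∈ unitDisk) :
    ‖deriv (deriv (cesaroOp μ α (zero_lt_one.trans_le hα) f : ℂ → ℂ)) z‖ₑ
      ≤ ENNReal.ofReal (8 * (α + 1) ^ 2 * M) * blochMajorant μ α z := by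
  have hM := nonneg_of_mem_blochBall hf
  rw [deriv2_cesaroOp_eq_integral μ _ f hz, blochMajorant,
    ← lintegral_const_mul' _ _ ENNReal.ofReal_ne_top]
  refine (enorm_integral_le_lintegral_enorm _).trans (lintegral_mono fun t => ?_)
  dsimp only
  rw [← ENNReal.ofReal_mul (by positivity), ← ofReal_norm, norm_mul, norm_pow,
    Complex.norm_real, Real.norm_of_nonneg t.2.1]
  refine ENNReal.ofReal_le_ofReal ?_
  refine (mul_le_of_le_one_left (norm_nonneg _) (pow_le_one₀ t.2.1 t.2.2.le)).trans ?_
  exact norm_deriv2_cesaroIntegrand_le hα hf t.2.1 t.2.2 hz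

theorem cesaroOp_mem_besovOneSubmodule (μ : Measure (Set.Ico (0 : ℝ) 1)) [IsFiniteMeasure μ]
    {α : ℝ} (hα : 1 ≤ α)
    (hμ : ∫⁻ t, ENNReal.ofReal
      (Real.log (Real.exp 1 / (1 - (t : ℝ))) / (1 - (t : ℝ)) ^ α) ∂μ < ⊤)
    {M : ℝ} {f : HolDisk} (hf : f ∈ blochBall M) :
    cesaroOp μ α (zero_lt_one.trans_le hα) f ∈ besovOneSubmodule := by
  set F := cesaroOp μ α (zero_lt_one.trans_le hα) f with hF
  have hc : ContinuousOn (deriv (deriv (F : ℂ → ℂ))) unitDisk :=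
    (HolDisk.analyticOnNhd F).deriv.deriv.continuousOn
  refine ⟨hc.aestronglyMeasurable measurableSet_ball, ?_⟩
  refine (setLIntegral_mono' measurableSet_ball
    fun z hz => enorm_deriv2_cesaroOp_le μ hα hf hz).trans_lt ?_
  rw [lintegral_const_mul' _ _ ENNReal.ofReal_ne_top]
  exact ENNReal.mul_lt_top ENNReal.ofReal_lt_top (lintegral_blochMajorant_lt_top μ α hμ)

/-! ### Compactness of Bloch balls and of their images -/

theorem gammaCoeff_one (m : ℕ) : gammaCoeff 1 m = 1 := by
  have : (m.factorial : ℝ) ≠ 0 := by exact_mod_cast m.factorial_ne_zero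
  rw [gammaCoeff, Real.Gamma_nat_eq_factorial, Real.Gamma_one, one_mul, div_self this]

theorem gammaCoeff_nonneg {α : ℝ} (hα : 0 < α) (m : ℕ) : 0 ≤ gammaCoeff α m :=
  div_nonneg (Real.Gamma_pos_of_pos (by positivity)).le
    (mul_nonneg (Real.Gamma_pos_of_pos hα).le (by positivity))

-- Turns a limit of coefficient sequences back into a function on the disc.
open Classical in
theorem exists_holDisk_of_bounded {a : ℕ → ℂ} {R : ℝ} (ha : ∀ n, ‖a n‖ ≤ R) :
    ∃ f : HolDisk, ∀ n, taylorCoeff (f : ℂ → ℂ) n = a n := by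
  have hsum : ∀ r : ℝ, 0 ≤ r → r < 1 → Summable fun n : ℕ => R * r ^ n := fun r h0 h1 =>
    (summable_geometric_of_lt_one h0 h1).mul_left R
  have hbd : ∀ (n : ℕ) (z : ℂ) (r : ℝ), ‖z‖ ≤ r → ‖a n * z ^ n‖ ≤ R * r ^ n := fun n z r hz => by
    rw [norm_mul, norm_pow]
    have := (norm_nonneg _).trans (ha n)
    have := ha n
    gcongr
  have key : DifferentiableOn ℂ (fun z => ∑' n, a n * z ^ n) unitDisk := by
    intro z hz
    obtain ⟨r, hzr, hr1⟩ := exists_between (show ‖z‖ < 1 by simpa using hz)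
    have h0 : 0 ≤ r := (norm_nonneg z).trans hzr.le
    have := Complex.differentiableOn_tsum_of_summable_norm
      (F := fun n (w : ℂ) => a n * w ^ n) (U := Metric.ball 0 r)
      (hsum r h0 hr1) (fun n => by fun_prop) Metric.isOpen_ball
      (fun n w hw => hbd n w r (mem_ball_zero_iff.1 hw).le)
    exact (this.differentiableAt
      (Metric.isOpen_ball.mem_nhds (by simpa using hzr))).differentiableWithinAt
  refine ⟨⟨fun z => if z ∈ unitDisk then ∑' n, a n * z ^ n else 0,
    key.congr fun z hz => if_pos hz, fun z hz => if_neg hz⟩, fun n => ?_⟩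
  refine taylorCoeff_eq_of_hasSum (fun z hz => ?_) n
  have hz' : ‖z‖ < 1 := by simpa using hz
  simp only [if_pos hz]
  exact (Summable.of_norm_bounded (hsum ‖z‖ (norm_nonneg z) hz')
    fun n => hbd n z _ le_rfl).hasSum

section

open Filter Topology

/-- Convergence of Taylor coefficients under a common bound gives pointwise convergence of
derivatives. -/
theorem tendsto_deriv_of_tendsto_taylorCoeff {fs : ℕ → ℂ → ℂ} {f g : ℂ → ℂ}
    (hfs : ∀ n, DifferentiableOn ℂ (fs n) unitDisk) (hf : DifferentiableOn ℂ f unitDisk)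
    (hg : DifferentiableOn ℂ g unitDisk)
    (hbd : ∀ n k, ‖taylorCoeff (fs n) k‖ ≤ ‖taylorCoeff g k‖)
    (hlim : ∀ k, Tendsto (fun n => taylorCoeff (fs n) k) atTop (𝓝 (taylorCoeff f k))) {z : ℂ}
    (hz : z ∈ unitDisk) :
    Tendsto (fun n => deriv (fs n) z) atTop (𝓝 (deriv f z)) := by
  have hd : ∀ {h : ℂ → ℂ}, DifferentiableOn ℂ h unitDisk →
      HasSum (fun k : ℕ => ((k : ℂ) + 1) * taylorCoeff h (k + 1) * z ^ k) (deriv h z) :=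
    fun {h} hh => HasSum.of_eq (hasSum_taylorCoeff (hh.deriv Metric.isOpen_ball) hz)
      fun k => by rw [taylorCoeff_deriv]
  simp_rw [← (hd hf).tsum_eq, ← fun n => (hd (hfs n)).tsum_eq]
  refine tendsto_tsum_of_dominated_convergence (hd hg).summable.norm
    (fun k => ((hlim (k + 1)).const_mul _).mul_const _) (Eventually.of_forall fun n k => ?_)
  simp only [norm_mul]
  gcongr
  exact hbd n (k + 1)

/-- `R / (1 - w)` has constant coefficients `R`, so it dominates every power series with
coefficients bounded by `R`. -/
theorem norm_taylorCoeff_one_sub_inv (R : ℝ) (hR : 0 ≤ R) (k : ℕ) :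
    ‖taylorCoeff (fun w => (R : ℂ) * (1 - w) ^ (-((1 : ℝ) : ℂ))) k‖ = R := by
  rw [taylorCoeff_const_mul _ (differentiableOn_one_sub_cpow _),
    taylorCoeff_one_sub_cpow one_pos, gammaCoeff_one, Complex.ofReal_one, mul_one,
    Complex.norm_real, Real.norm_of_nonneg hR]

/-- Balls of the Bloch space are compact for the convergence of Taylor coefficients. -/
theorem exists_subseq_blochBall {M : ℝ} {fs : ℕ → HolDisk} (hfs : ∀ n, fs n ∈ blochBall M) :
    ∃ f ∈ blochBall M, ∃ φ : ℕ → ℕ, StrictMono φ ∧ ∀ k,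
      Tendsto (fun n => taylorCoeff (fs (φ n) : ℂ → ℂ) k) atTop
        (𝓝 (taylorCoeff (f : ℂ → ℂ) k)) := by
  have hM := nonneg_of_mem_blochBall (hfs 0)
  -- Coefficients of the whole ball are bounded by `6M`; Tychonoff in a countable product of discs
  -- yields a coefficientwise convergent subsequence.
  have hK : IsCompact (Set.pi Set.univ fun _ : ℕ => Metric.closedBall (0 : ℂ) (6 * M)) :=
    isCompact_univ_pi fun _ => isCompact_closedBall 0 _
  obtain ⟨a, ha, φ, hφ, hlim⟩ := hK.tendsto_subseq
    (x := fun n k => taylorCoeff (fs n : ℂ → ℂ) k) fun n k _ => by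
      rw [mem_closedBall_zero_iff]
      exact norm_taylorCoeff_le_of_mem_blochBall (hfs n) k
  obtain ⟨f, hf⟩ := exists_holDisk_of_bounded (a := a) (R := 6 * M) fun k => by
    simpa using ha k (Set.mem_univ k)
  have hlim' : ∀ k, Tendsto (fun n => taylorCoeff (fs (φ n) : ℂ → ℂ) k) atTop
      (𝓝 (taylorCoeff (f : ℂ → ℂ) k)) := fun k => by
    rw [hf k]
    exact (tendsto_pi_nhds.1 hlim k)
  refine ⟨f, ⟨?_, fun z hz => ?_⟩, φ, hφ, hlim'⟩
  · have := (hlim' 0).norm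
    simp only [taylorCoeff, iteratedDeriv_zero, Nat.factorial_zero, Nat.cast_one, div_one] at this
    exact le_of_tendsto' this fun n => (hfs (φ n)).1
  · have := tendsto_deriv_of_tendsto_taylorCoeff (fun n => (fs (φ n)).2.1) f.2.1
      ((differentiableOn_one_sub_cpow ((1 : ℝ) : ℂ)).const_mul ((6 * M : ℝ) : ℂ))
      (fun n k => by
        rw [norm_taylorCoeff_one_sub_inv _ (by positivity)]
        exact norm_taylorCoeff_le_of_mem_blochBall (hfs (φ n)) k) hlim' hz
    exact le_of_tendsto' (this.norm.const_mul (1 - ‖z‖ ^ 2)) fun n => (hfs (φ n)).2 z hz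

/-- Each coefficient of the image involves finitely many coefficients of `f`, so coefficientwise
convergence passes through. Domination comes from applying the same formula to `6M / (1 - w)`, with
the moments replaced by the total mass. -/
theorem tendsto_deriv2_cesaroOp (μ : Measure (Set.Ico (0 : ℝ) 1)) [IsFiniteMeasure μ] {α : ℝ}
    (hα : 0 < α) {M : ℝ} {fs : ℕ → HolDisk} {f : HolDisk} (hfs : ∀ n, fs n ∈ blochBall M)
    (hlim : ∀ k, Tendsto (fun n => taylorCoeff (fs n : ℂ → ℂ) k) atTop
        (𝓝 (taylorCoeff (f : ℂ → ℂ) k))) :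
    (∀ k, Tendsto (fun n => taylorCoeff (cesaroOp μ α hα (fs n) : ℂ → ℂ) k) atTop
        (𝓝 (taylorCoeff (cesaroOp μ α hα f : ℂ → ℂ) k))) ∧
    ∀ z ∈ unitDisk, Tendsto (fun n => deriv (deriv (cesaroOp μ α hα (fs n) : ℂ → ℂ)) z) atTop
      (𝓝 (deriv (deriv (cesaroOp μ α hα f : ℂ → ℂ)) z)) := by
  have hM := nonneg_of_mem_blochBall (hfs 0)
  have hco : ∀ k, Tendsto (fun n => taylorCoeff (cesaroOp μ α hα (fs n) : ℂ → ℂ) k) atTop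
      (𝓝 (taylorCoeff (cesaroOp μ α hα f : ℂ → ℂ) k)) := fun k => by
    simp_rw [taylorCoeff_cesaroOp, cesaroCoeff]
    exact (tendsto_finsetSum _ fun j _ => (hlim j).const_mul _).const_mul _
  refine ⟨hco, fun z hz => ?_⟩
  set u : ℂ → ℂ := fun w => ((6 * M : ℝ) : ℂ) * (1 - w) ^ (-((1 : ℝ) : ℂ)) with hu
  have hud : DifferentiableOn ℂ u unitDisk :=
    (differentiableOn_one_sub_cpow ((1 : ℝ) : ℂ)).const_mul _
  have hgd := (differentiableOn_cesaroIntegrand α hud).const_mul ((μ.real Set.univ : ℝ) : ℂ)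
  refine tendsto_deriv_of_tendsto_taylorCoeff
    (fun n => (cesaroOp μ α hα (fs n)).2.1.deriv Metric.isOpen_ball)
    ((cesaroOp μ α hα f).2.1.deriv Metric.isOpen_ball) (hgd.deriv Metric.isOpen_ball)
    (fun n k => ?_) (fun k => ?_) hz
  · rw [taylorCoeff_deriv, taylorCoeff_deriv, norm_mul, norm_mul, taylorCoeff_cesaroOp,
      taylorCoeff_const_mul _ (differentiableOn_cesaroIntegrand α hud),
      taylorCoeff_cesaroIntegrand hα hud, cesaroCoeff]
    have hut : ∀ j, taylorCoeff u j = ((6 * M : ℝ) : ℂ) := fun j => by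
      rw [hu, taylorCoeff_const_mul _ (differentiableOn_one_sub_cpow _),
        taylorCoeff_one_sub_cpow one_pos, gammaCoeff_one, Complex.ofReal_one, mul_one]
    refine mul_le_mul_of_nonneg_left ?_ (norm_nonneg _)
    rw [norm_mul, norm_mul, Complex.norm_real, Complex.norm_real,
      Real.norm_of_nonneg (measureReal_nonneg (μ := μ))]
    refine mul_le_mul (abs_moment_le μ _) ?_ (norm_nonneg _) measureReal_nonneg
    simp_rw [hut]
    rw [← Finset.sum_mul, norm_mul, Complex.norm_real, Real.norm_of_nonneg (by positivity),
      ← Complex.ofReal_sum, Complex.norm_real,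
      Real.norm_of_nonneg (Finset.sum_nonneg fun j _ => gammaCoeff_nonneg hα _), Finset.sum_mul]
    refine (norm_sum_le _ _).trans (Finset.sum_le_sum fun j _ => ?_)
    rw [norm_mul, Complex.norm_real, Real.norm_of_nonneg (gammaCoeff_nonneg hα _)]
    exact mul_le_mul_of_nonneg_left (norm_taylorCoeff_le_of_mem_blochBall (hfs n) j)
      (gammaCoeff_nonneg hα _)
  · simp_rw [taylorCoeff_deriv]
    exact (hco (k + 1)).const_mul _

theorem HolDisk.deriv_sub {f g : HolDisk} {z : ℂ} (hz : z ∈ unitDisk) :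
    deriv ((f - g : HolDisk) : ℂ → ℂ) z = deriv (f : ℂ → ℂ) z - deriv (g : ℂ → ℂ) z := by
  rw [eq_sub_iff_add_eq, ← HolDisk.deriv_add hz, sub_add_cancel]

theorem HolDisk.deriv2_sub {f g : HolDisk} {z : ℂ} (hz : z ∈ unitDisk) :
    deriv (deriv ((f - g : HolDisk) : ℂ → ℂ)) z
      = deriv (deriv (f : ℂ → ℂ)) z - deriv (deriv (g : ℂ → ℂ)) z := by
  rw [eq_sub_iff_add_eq, ← HolDisk.deriv2_add hz, sub_add_cancel]

/-- A subsequence of preimages converges coefficientwise to a member of the same ball. Coefficients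
`0` and `1` control the first two terms of the norm of the difference; dominated convergence
controls the area integral. -/
theorem isCompact_cesaroOp_blochBall (μ : Measure (Set.Ico (0 : ℝ) 1)) [IsFiniteMeasure μ]
    {α : ℝ} (hα : 1 ≤ α)
    (hμ : ∫⁻ t, ENNReal.ofReal
      (Real.log (Real.exp 1 / (1 - (t : ℝ))) / (1 - (t : ℝ)) ^ α) ∂μ < ⊤) (M : ℝ) :
    IsCompact {g : BesovOne | ∃ f ∈ blochBall M,
      g.toHol = cesaroOp μ α (zero_lt_one.trans_le hα) f} := by
  set T := cesaroOp μ α (zero_lt_one.trans_le hα) with hT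
  refine IsSeqCompact.isCompact fun g hg => ?_
  choose fs hfs hgs using hg
  obtain ⟨f, hf, φ, hφ, hlim⟩ := exists_subseq_blochBall hfs
  obtain ⟨hco, hd2⟩ := tendsto_deriv2_cesaroOp μ (zero_lt_one.trans_le hα)
    (fun n => hfs (φ n)) hlim
  let G : BesovOne := ⟨T f, cesaroOp_mem_besovOneSubmodule μ hα hμ hf⟩
  have hG : G.toHol = T f := rfl
  refine ⟨G, ⟨f, hf, rfl⟩, φ, hφ, ?_⟩
  rw [tendsto_iff_norm_sub_tendsto_zero]
  have h0 : (0 : ℂ) ∈ unitDisk := by simp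
  have hsub : ∀ n, ((g ∘ φ) n - G).toHol = T (fs (φ n)) - T f := fun n => by
    rw [map_sub, hG, Function.comp_apply, hgs]
  simp_rw [BesovOne.norm_def, hsub]
  have e1 : ∀ n, ((T (fs (φ n)) - T f : HolDisk) : ℂ → ℂ) 0
      = taylorCoeff (T (fs (φ n)) : ℂ → ℂ) 0 - taylorCoeff (T f : ℂ → ℂ) 0 := fun n => by
    simp [taylorCoeff]
  have e2 : ∀ n, deriv ((T (fs (φ n)) - T f : HolDisk) : ℂ → ℂ) 0
      = taylorCoeff (T (fs (φ n)) : ℂ → ℂ) 1 - taylorCoeff (T f : ℂ → ℂ) 1 := fun n => by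
    rw [HolDisk.deriv_sub h0]
    simp [taylorCoeff]
  have l1 := tendsto_iff_norm_sub_tendsto_zero.1 (hco 0)
  have l2 := tendsto_iff_norm_sub_tendsto_zero.1 (hco 1)
  set c := ENNReal.ofReal (8 * (α + 1) ^ 2 * M) with hc
  have hcont : ∀ h : HolDisk, ContinuousOn (deriv (deriv (h : ℂ → ℂ))) unitDisk := fun h =>
    (HolDisk.analyticOnNhd h).deriv.deriv.continuousOn
  have l3 : Tendsto (fun n => ∫⁻ z in unitDisk,
      ‖deriv (deriv ((T (fs (φ n)) - T f : HolDisk) : ℂ → ℂ)) z‖ₑ) atTop (𝓝 0) := by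
    rw [← lintegral_zero (μ := volume.restrict unitDisk)]
    refine tendsto_lintegral_of_dominated_convergence'
      -- One copy of the majorant for the sequence and one for its limit.
      (fun z => c * blochMajorant μ α z + c * blochMajorant μ α z)
      (fun n => ((hcont _).aestronglyMeasurable measurableSet_ball).enorm) (fun n => ?_) ?_ ?_
    · filter_upwards [ae_restrict_mem measurableSet_ball] with z hz
      rw [HolDisk.deriv2_sub hz]
      exact (enorm_sub_le).trans (add_le_add
        (enorm_deriv2_cesaroOp_le μ hα (hfs (φ n)) hz) (enorm_deriv2_cesaroOp_le μ hα hf hz))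
    · rw [lintegral_add_left ((measurable_blochMajorant μ α).const_mul c),
        lintegral_const_mul' _ _ ENNReal.ofReal_ne_top]
      have := ENNReal.mul_lt_top (ENNReal.ofReal_lt_top (r := 8 * (α + 1) ^ 2 * M))
        (lintegral_blochMajorant_lt_top μ α hμ)
      exact (ENNReal.add_lt_top.2 ⟨this, this⟩).ne
    · filter_upwards [ae_restrict_mem measurableSet_ball] with z hz
      simp_rw [HolDisk.deriv2_sub hz]
      have := tendsto_iff_norm_sub_tendsto_zero.1 (hd2 z hz)
      have := (ENNReal.tendsto_ofReal this)
      simpa only [ofReal_norm, ENNReal.ofReal_zero] using this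
  have l4 : Tendsto (fun n => ∫ z in unitDisk,
      ‖deriv (deriv ((T (fs (φ n)) - T f : HolDisk) : ℂ → ℂ)) z‖) atTop (𝓝 0) := by
    have := (ENNReal.tendsto_toReal ENNReal.zero_ne_top).comp l3
    refine this.congr fun n => ?_
    exact (integral_norm_eq_lintegral_enorm
      ((hcont _).aestronglyMeasurable measurableSet_ball)).symm
  simp_rw [e1, e2]
  simpa using (l1.add l2).add (l4.const_mul Real.pi⁻¹)

/-! ### Banach subspaces of the Bloch space -/

variable {X : Type*} [NormedAddCommGroup X] [NormedSpace ℂ X] [CompleteSpace X]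

/-- Derivatives at points of the disc are continuous on a Banach subspace of `H(𝔻)`. -/
theorem continuous_deriv_apply (ι : X →ₗ[ℂ] HolDisk)
    (hev : ∀ z ∈ unitDisk, Continuous fun x => (ι x : ℂ → ℂ) z) {z : ℂ} (hz : z ∈ unitDisk) :
    Continuous fun x => deriv (ι x : ℂ → ℂ) z := by
  have hz' : ‖z‖ < 1 := by simpa using hz
  let E : ∀ w ∈ unitDisk, X →L[ℂ] ℂ := fun w hw =>
    { toFun := fun x => (ι x : ℂ → ℂ) w
      map_add' := fun x y => by simp
      map_smul' := fun c x => by simp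
      cont := hev w hw }
  let h : ℕ → ℂ := fun n => (((1 - ‖z‖) / (n + 2) : ℝ) : ℂ)
  have hpos : ∀ n : ℕ, 0 < (1 - ‖z‖) / ((n : ℝ) + 2) := fun n =>
    div_pos (by linarith) (by positivity)
  have hh0 : ∀ n, h n ≠ 0 := fun n => Complex.ofReal_ne_zero.2 (hpos n).ne'
  have hmem : ∀ n, z + h n ∈ unitDisk := fun n => by
    rw [mem_ball_zero_iff]
    refine (norm_add_le _ _).trans_lt ?_
    rw [Complex.norm_real, Real.norm_of_nonneg (hpos n).le]
    have : (1 - ‖z‖) / ((n : ℝ) + 2) < 1 - ‖z‖ :=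
      div_lt_self (by linarith) (by linarith [(n.cast_nonneg : (0 : ℝ) ≤ n)])
    linarith
  have hlim : Tendsto h atTop (𝓝[≠] 0) := by
    refine tendsto_nhdsWithin_iff.2 ⟨?_, Eventually.of_forall hh0⟩
    have : Tendsto (fun n : ℕ => (1 - ‖z‖) / ((n : ℝ) + 2)) atTop (𝓝 0) :=
      tendsto_const_nhds.div_atTop (tendsto_atTop_add_const_right _ _ tendsto_natCast_atTop_atTop)
    have := (Complex.continuous_ofReal.tendsto 0).comp this
    rwa [Complex.ofReal_zero] at this
  -- The derivative is the pointwise limit of difference quotients, which are continuous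
  -- functionals; on a Banach space such a limit is continuous.
  let g : ℕ → X →L[ℂ] ℂ := fun n => (h n)⁻¹ • (E (z + h n) (hmem n) - E z hz)
  have hg : Tendsto (fun n x => g n x) atTop (𝓝 fun x => deriv (ι x : ℂ → ℂ) z) := by
    refine tendsto_pi_nhds.2 fun x => ?_
    have := (HolDisk.analyticOnNhd (ι x) z hz).differentiableAt.hasDerivAt
    exact (hasDerivAt_iff_tendsto_slope_zero.1 this).comp hlim
  exact (continuousLinearMapOfTendsto g hg).continuous

/-- A Banach subspace of `H(𝔻)` contained in the Bloch space is boundedly contained in it. -/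
theorem exists_forall_mem_blochBall (ι : X →ₗ[ℂ] HolDisk)
    (hev : ∀ z ∈ unitDisk, Continuous fun x => (ι x : ℂ → ℂ) z)
    (hXB : Set.range ι ⊆ blochSpace) :
    ∃ M : ℝ, ∀ x, ‖x‖ ≤ 1 → ι x ∈ blochBall M := by
  have h0 : (0 : ℂ) ∈ unitDisk := by simp
  let E : X →L[ℂ] ℂ :=
    { toFun := fun x => (ι x : ℂ → ℂ) 0
      map_add' := fun x y => by simp
      map_smul' := fun c x => by simp
      cont := hev 0 h0 }
  let D : unitDisk → X →L[ℂ] ℂ := fun z =>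
    { toFun := fun x => ((1 - ‖(z : ℂ)‖ ^ 2 : ℝ) : ℂ) * deriv (ι x : ℂ → ℂ) z
      map_add' := fun x y => by rw [map_add, HolDisk.deriv_add z.2, mul_add]
      map_smul' := fun c x => by
        rw [map_smul, HolDisk.deriv_smul c z.2, RingHom.id_apply, smul_eq_mul, smul_eq_mul]
        ring
      cont := (continuous_deriv_apply ι hev z.2).const_mul _ }
  have hnn : ∀ z : unitDisk, 0 ≤ 1 - ‖(z : ℂ)‖ ^ 2 := fun z => by
    have := mem_ball_zero_iff.1 z.2
    nlinarith [norm_nonneg (z : ℂ)]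
  have hD : ∀ z x, ‖D z x‖ = (1 - ‖(z : ℂ)‖ ^ 2) * ‖deriv (ι x : ℂ → ℂ) z‖ := fun z x => by
    change ‖((1 - ‖(z : ℂ)‖ ^ 2 : ℝ) : ℂ) * deriv (ι x : ℂ → ℂ) z‖ = _
    rw [norm_mul, Complex.norm_real, Real.norm_of_nonneg (hnn z)]
  -- The functionals `x ↦ (1 - |z|²) (ι x)'(z)` are pointwise bounded because every `ι x` is Bloch.
  obtain ⟨C, hC⟩ := banach_steinhaus (g := D) fun x => by
    obtain ⟨M, hM⟩ := hXB ⟨x, rfl⟩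
    exact ⟨M, fun z => (hD z x).trans_le (hM z z.2)⟩
  refine ⟨max ‖E‖ C, fun x hx => ⟨?_, fun z hz => ?_⟩⟩
  · exact ((E.le_opNorm x).trans (mul_le_of_le_one_right (norm_nonneg _) hx)).trans
      (le_max_left _ _)
  · rw [← hD ⟨z, hz⟩ x]
    exact (((D ⟨z, hz⟩).le_opNorm x).trans
      (mul_le_of_le_one_right (norm_nonneg _) hx)).trans ((hC _).trans (le_max_right _ _))

/-- The unit ball of `X` lies in a Bloch ball, whose image is compact. Continuity of the operator is
then a consequence of its compactness. -/
theorem isCompactToBesovOne_cesaroOp (μ : Measure (Set.Ico (0 : ℝ) 1)) [IsFiniteMeasure μ]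
    {α : ℝ} (hα : 1 ≤ α) (ι : X →ₗ[ℂ] HolDisk)
    (hev : ∀ z ∈ unitDisk, Continuous fun x => (ι x : ℂ → ℂ) z)
    (hXB : Set.range ι ⊆ blochSpace)
    (hμ : ∫⁻ t, ENNReal.ofReal
      (Real.log (Real.exp 1 / (1 - (t : ℝ))) / (1 - (t : ℝ)) ^ α) ∂μ < ⊤) :
    IsCompactToBesovOne ι (cesaroOp μ α (zero_lt_one.trans_le hα)) := by
  obtain ⟨M, hM⟩ := exists_forall_mem_blochBall ι hev hXB
  have hmem : ∀ x, cesaroOp μ α (zero_lt_one.trans_le hα) (ι x) ∈ besovOneSubmodule := fun x => by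
    obtain ⟨K, hK⟩ := hXB ⟨x, rfl⟩
    exact cesaroOp_mem_besovOneSubmodule μ hα hμ (M := max ‖(ι x : ℂ → ℂ) 0‖ K)
      ⟨le_max_left _ _, fun z hz => (hK z hz).trans (le_max_right _ _)⟩
  let b : X → BesovOne := fun x => ⟨cesaroOp μ α (zero_lt_one.trans_le hα) (ι x), hmem x⟩
  have hb : ∀ x, (b x).toHol = cesaroOp μ α (zero_lt_one.trans_le hα) (ι x) := fun _ => rfl
  let S : X →ₗ[ℂ] BesovOne :=
    { toFun := b
      map_add' := fun x y => BesovOne.toHol_injective (by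
        rw [map_add, hb, hb, hb, map_add, map_add])
      map_smul' := fun c x => BesovOne.toHol_injective (by
        rw [map_smul, hb, hb, map_smul, map_smul, RingHom.id_apply]) }
  have hS : IsCompactOperator S := by
    rw [isCompactOperator_iff_image_closedBall_subset_compact S one_pos]
    refine ⟨_, isCompact_cesaroOp_blochBall μ hα hμ M, ?_⟩
    rintro _ ⟨x, hx, rfl⟩
    exact ⟨ι x, hM x (mem_closedBall_zero_iff.1 hx), rfl⟩
  exact ⟨⟨S, hS.continuous⟩, hS, fun x => rfl⟩

end

/-! ### Boundedness of `B_1` functions on the radius -/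

theorem integral_circleMap_eq {E : Type*} [NormedAddCommGroup E] [NormedSpace ℝ E] (f : ℂ → E)
    (r : ℝ) :
    ∫ θ in (0 : ℝ)..2 * Real.pi, f (circleMap 0 r θ)
      = ∫ θ in -Real.pi..Real.pi, f (circleMap 0 r θ) := by
  have hp : Function.Periodic (fun θ => f (circleMap 0 r θ)) (2 * Real.pi) := fun θ => by
    simp only [periodic_circleMap 0 r θ]
  have := hp.intervalIntegral_add_eq 0 (-Real.pi)
  rwa [zero_add, show -Real.pi + 2 * Real.pi = Real.pi by ring] at this

/-- Cauchy's formula on `|z| = r`: the point `ρr²` is at distance at least `r (1 - r)` from the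
circle, and `1 - r² ≤ 2 (1 - r)`. The point is chosen to fit the substitution in
`integral_deriv2_eq`. -/
theorem one_sub_sq_mul_norm_le {G : ℂ → ℂ} (hG : DifferentiableOn ℂ G unitDisk) {ρ r : ℝ}
    (hρ0 : 0 ≤ ρ) (hρ1 : ρ < 1) (hr0 : 0 < r) (hr1 : r < 1) :
    (1 - r ^ 2) * ‖G ((ρ * r ^ 2 : ℝ) : ℂ)‖
      ≤ Real.pi⁻¹ * ∫ θ in -Real.pi..Real.pi, ‖G (circleMap 0 r θ)‖ := by
  have hpi := Real.pi_pos
  have hsub : Metric.closedBall (0 : ℂ) r ⊆ unitDisk := Metric.closedBall_subset_ball hr1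
  have hρr : ρ * r < 1 := by nlinarith
  have hwn : ‖((ρ * r ^ 2 : ℝ) : ℂ)‖ = ρ * r ^ 2 := by
    rw [Complex.norm_real, Real.norm_of_nonneg (by positivity)]
  have hw : ((ρ * r ^ 2 : ℝ) : ℂ) ∈ Metric.ball (0 : ℂ) r := by
    rw [mem_ball_zero_iff, hwn]
    nlinarith
  have hcauchy := Complex.circleIntegral_sub_inv_smul_of_differentiable_on_off_countable
    Set.countable_empty hw (hG.continuousOn.mono hsub)
    (fun x hx => hG.differentiableAt (Metric.isOpen_ball.mem_nhds
      (hsub (Metric.ball_subset_closedBall hx.1))))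
  have hcont : Continuous fun θ => ‖G (circleMap 0 r θ)‖ := by
    refine (hG.continuousOn.comp_continuous (continuous_circleMap 0 r) fun θ => ?_).norm
    exact hsub (circleMap_mem_closedBall 0 hr0.le θ)
  have hb : ‖∮ z in C(0, r), (z - ((ρ * r ^ 2 : ℝ) : ℂ))⁻¹ • G z‖
      ≤ ∫ θ in (0 : ℝ)..2 * Real.pi, (1 - r)⁻¹ * ‖G (circleMap 0 r θ)‖ := by
    refine intervalIntegral.norm_integral_le_of_norm_le (by positivity)
      (Filter.Eventually.of_forall fun θ _ => ?_)
      (hcont.const_mul _).continuousOn.intervalIntegrable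
    rw [norm_smul, norm_smul, norm_inv, ← mul_assoc]
    refine mul_le_mul_of_nonneg_right ?_ (norm_nonneg _)
    have h1 : ‖deriv (circleMap 0 r) θ‖ = r := by
      simp [deriv_circleMap, abs_of_pos hr0]
    have h2 : r * (1 - r) ≤ ‖circleMap 0 r θ - ((ρ * r ^ 2 : ℝ) : ℂ)‖ := by
      have := norm_sub_norm_le (circleMap 0 r θ) ((ρ * r ^ 2 : ℝ) : ℂ)
      rw [norm_circleMap_zero, abs_of_pos hr0, hwn] at this
      refine this.trans' ?_
      nlinarith [mul_pos hr0 hr0]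
    have h3 : 0 < 1 - r := by linarith
    rw [h1, ← div_eq_mul_inv, div_le_iff₀ (h2.trans_lt' (by positivity))]
    rw [inv_mul_eq_div, le_div_iff₀ h3]
    exact h2
  rw [hcauchy, intervalIntegral.integral_const_mul,
    integral_circleMap_eq (fun z => ‖G z‖) r, norm_smul] at hb
  have h2pi : ‖(2 * Real.pi * Complex.I : ℂ)‖ = 2 * Real.pi := by
    simp [abs_of_pos hpi]
  rw [h2pi] at hb
  set I := ∫ θ in -Real.pi..Real.pi, ‖G (circleMap 0 r θ)‖ with hI
  have hI0 : 0 ≤ I := intervalIntegral.integral_nonneg (by linarith) fun _ _ => norm_nonneg _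
  have h3 : 0 < 1 - r := by linarith
  have hb' : 2 * Real.pi * ‖G ((ρ * r ^ 2 : ℝ) : ℂ)‖ * (1 - r) ≤ I := by
    rw [inv_mul_eq_div, le_div_iff₀ h3] at hb
    exact hb
  rw [inv_mul_eq_div, le_div_iff₀ hpi]
  have h4 : 0 ≤ Real.pi * ‖G ((ρ * r ^ 2 : ℝ) : ℂ)‖ * (1 - r) := by positivity
  nlinarith

/-- Taylor's formula with remainder `∫ (ρ - x) F''(x) dx` over `[0, ρ]`, after `x = ρr²`. The
substitution produces both the weight `1 - r²` needed to bound `F''` by a circle mean and the factor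
`r` of the area element. -/
theorem integral_deriv2_eq {F : ℂ → ℂ} (hF : DifferentiableOn ℂ F unitDisk) {ρ : ℝ} (hρ0 : 0 ≤ ρ)
    (hρ1 : ρ < 1) :
    ∫ r in (0 : ℝ)..1, ((2 * r * (1 - r ^ 2) * ρ ^ 2 : ℝ) : ℂ)
        * deriv (deriv F) ((ρ * r ^ 2 : ℝ) : ℂ) = F ρ - F 0 - ρ * deriv F 0 := by
  have hmem : ∀ r ∈ Set.uIcc (0 : ℝ) 1, ((ρ * r ^ 2 : ℝ) : ℂ) ∈ unitDisk := fun r hr => by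
    rw [Set.uIcc_of_le zero_le_one] at hr
    rw [mem_ball_zero_iff, Complex.norm_real, Real.norm_of_nonneg (by positivity)]
    have : r ^ 2 ≤ 1 := pow_le_one₀ hr.1 hr.2
    nlinarith
  have hF1 := hF.deriv Metric.isOpen_ball
  have hF2 := hF1.deriv Metric.isOpen_ball
  have hd : ∀ r ∈ Set.uIcc (0 : ℝ) 1, HasDerivAt
      (fun r : ℝ => ((1 - r ^ 2 : ℝ) : ℂ) * (ρ * deriv F ((ρ * r ^ 2 : ℝ) : ℂ))
        + F ((ρ * r ^ 2 : ℝ) : ℂ))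
      (((2 * r * (1 - r ^ 2) * ρ ^ 2 : ℝ) : ℂ) * deriv (deriv F) ((ρ * r ^ 2 : ℝ) : ℂ)) r := by
    intro r hr
    have hn := Metric.isOpen_ball.mem_nhds (hmem r hr)
    have h1 : HasDerivAt (fun r : ℝ => ((ρ * r ^ 2 : ℝ) : ℂ)) ((ρ * (2 * r) : ℝ) : ℂ) r := by
      have := ((hasDerivAt_pow 2 r).const_mul ρ).ofReal_comp
      simpa using this
    have h2 : HasDerivAt (fun r : ℝ => ((1 - r ^ 2 : ℝ) : ℂ)) ((-(2 * r) : ℝ) : ℂ) r := by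
      have := ((hasDerivAt_pow 2 r).const_sub 1).ofReal_comp
      simpa using this
    have h3 := (hF.differentiableAt hn).hasDerivAt.comp_of_eq r h1 rfl
    have h4 := (hF1.differentiableAt hn).hasDerivAt.comp_of_eq r h1 rfl
    refine ((h2.mul (h4.const_mul (ρ : ℂ))).add h3).congr_deriv ?_
    simp only [Function.comp_apply]
    push_cast
    ring
  rw [intervalIntegral.integral_eq_sub_of_hasDerivAt hd]
  · simp
    ring
  · refine ContinuousOn.intervalIntegrable (ContinuousOn.mul (by fun_prop) ?_)
    exact hF2.continuousOn.comp (by fun_prop) hmem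

/-- Point evaluations on `[0, 1)` are uniformly bounded on `B_1`. -/
theorem BesovOne.norm_apply_ofReal_le (g : BesovOne) {ρ : ℝ} (hρ0 : 0 ≤ ρ) (hρ1 : ρ < 1) :
    ‖(g.toHol : ℂ → ℂ) ρ‖ ≤ 2 * ‖g‖ := by
  have hpi := Real.pi_pos
  set F : ℂ → ℂ := (g.toHol : ℂ → ℂ) with hFdef
  have hF : DifferentiableOn ℂ F unitDisk := g.toHol.2.1
  have hF2 := (hF.deriv Metric.isOpen_ball).deriv Metric.isOpen_ball
  have hI := g.integrableOn
  rw [← hFdef] at hI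
  have hmain : ‖∫ r in (0 : ℝ)..1, ((2 * r * (1 - r ^ 2) * ρ ^ 2 : ℝ) : ℂ)
        * deriv (deriv F) ((ρ * r ^ 2 : ℝ) : ℂ)‖ₑ
      ≤ ENNReal.ofReal (2 * (Real.pi⁻¹ * ∫ z in unitDisk, ‖deriv (deriv F) z‖)) := by
    rw [intervalIntegral.integral_of_le zero_le_one, integral_Ioc_eq_integral_Ioo]
    refine (enorm_integral_le_lintegral_enorm _).trans ?_
    rw [← mul_assoc, ENNReal.ofReal_mul (by positivity), integral_norm_eq_lintegral_enorm
      hI.aestronglyMeasurable, ENNReal.ofReal_toReal hI.2.ne,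
      lintegral_unitDisk_eq (measurable_deriv _).enorm,
      ← lintegral_const_mul' _ _ ENNReal.ofReal_ne_top]
    -- The remainder and the area integral are compared radius by radius.
    refine setLIntegral_mono' measurableSet_Ioo fun r hr => ?_
    have hr2 : 0 ≤ 1 - r ^ 2 := by nlinarith [hr.1, hr.2]
    have hcont : Continuous fun θ => ‖deriv (deriv F) (circleMap 0 r θ)‖ := by
      refine (hF2.continuousOn.comp_continuous (continuous_circleMap 0 r) fun θ => ?_).norm
      exact Metric.closedBall_subset_ball hr.2 (circleMap_mem_closedBall 0 hr.1.le θ)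
    have e : ∫⁻ θ in Set.Ioo (-Real.pi) Real.pi, ‖deriv (deriv F) (circleMap 0 r θ)‖ₑ
        = ENNReal.ofReal (∫ θ in -Real.pi..Real.pi, ‖deriv (deriv F) (circleMap 0 r θ)‖) := by
      rw [intervalIntegral.integral_of_le (by linarith), integral_Ioc_eq_integral_Ioo,
        ofReal_integral_eq_lintegral_ofReal
          (hcont.integrableOn_Icc.mono_set Set.Ioo_subset_Icc_self)
          (Filter.Eventually.of_forall fun _ => norm_nonneg _)]
      simp_rw [ofReal_norm]
    have hr0 := hr.1.le
    rw [e, ← ENNReal.ofReal_mul hr0, ← ENNReal.ofReal_mul (by positivity), ← ofReal_norm]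
    refine ENNReal.ofReal_le_ofReal ?_
    rw [norm_mul, Complex.norm_real, Real.norm_of_nonneg (by positivity)]
    have h := one_sub_sq_mul_norm_le hF2 hρ0 hρ1 hr.1 hr.2
    have hρ2 : ρ ^ 2 ≤ 1 := pow_le_one₀ hρ0 hρ1.le
    calc 2 * r * (1 - r ^ 2) * ρ ^ 2 * ‖deriv (deriv F) ((ρ * r ^ 2 : ℝ) : ℂ)‖
        = 2 * r * ρ ^ 2 * ((1 - r ^ 2) * ‖deriv (deriv F) ((ρ * r ^ 2 : ℝ) : ℂ)‖) := by ring
      _ ≤ 2 * r * 1 * (Real.pi⁻¹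
            * ∫ θ in -Real.pi..Real.pi, ‖deriv (deriv F) (circleMap 0 r θ)‖) := by gcongr
      _ = _ := by ring
  rw [integral_deriv2_eq hF hρ0 hρ1, ← ofReal_norm] at hmain
  have hint := g.integral_nonneg
  have h1 := (ENNReal.ofReal_le_ofReal_iff (by positivity)).1 hmain
  have h2 : F ρ = (F ρ - F 0 - ρ * deriv F 0) + F 0 + ρ * deriv F 0 := by ring
  have h3 : ‖(ρ : ℂ) * deriv F 0‖ ≤ ‖deriv F 0‖ := by
    rw [norm_mul, Complex.norm_real, Real.norm_of_nonneg hρ0]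
    exact mul_le_of_le_one_left (norm_nonneg _) hρ1.le
  have h4 := norm_add₃_le (a := F ρ - F 0 - ρ * deriv F 0) (b := F 0) (c := ρ * deriv F 0)
  rw [← h2] at h4
  rw [BesovOne.norm_def, ← hFdef]
  have := norm_nonneg (F 0)
  have := norm_nonneg (deriv F 0)
  linarith

/-! ### The test function `log (1 / (1 - z))` -/

theorem hasDerivAt_neg_log_one_sub {z : ℂ} (hz : z ∈ unitDisk) :
    HasDerivAt (fun z => -Complex.log (1 - z)) (1 - z)⁻¹ z := by
  have := (((hasDerivAt_id z).const_sub 1).clog (one_sub_mem_slitPlane hz)).neg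
  refine this.congr_deriv ?_
  simp [neg_div]

open Classical in
/-- The function `log (1 / (1 - z))` in the disc. -/
noncomputable def logHol : HolDisk :=
  ⟨fun z => if z ∈ unitDisk then -Complex.log (1 - z) else 0,
    DifferentiableOn.congr (fun _ hz =>
      (hasDerivAt_neg_log_one_sub hz).differentiableAt.differentiableWithinAt)
      (fun _ hz => if_pos hz), fun _ hz => if_neg hz⟩

theorem logHol_apply {z : ℂ} (hz : z ∈ unitDisk) : (logHol : ℂ → ℂ) z = -Complex.log (1 - z) :=
  if_pos hz

theorem deriv_logHol {z : ℂ} (hz : z ∈ unitDisk) : deriv (logHol : ℂ → ℂ) z = (1 - z)⁻¹ := by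
  have : (logHol : ℂ → ℂ) =ᶠ[nhds z] fun z => -Complex.log (1 - z) := by
    filter_upwards [Metric.isOpen_ball.mem_nhds hz] with w hw using logHol_apply hw
  rw [this.deriv_eq, (hasDerivAt_neg_log_one_sub hz).deriv]

/-- Here `|f'| = |1 - z|⁻¹`, whose `s`-th power has circle mean `O((1 - r)^(1 - s))`; the `s`-th
root cancels the weight `(1 - r)^(1 - 1/s)` exactly. -/
theorem logHol_mem_meanLipschitzSpace {s : ℝ} (hs : 1 < s) :
    logHol ∈ meanLipschitzSpace s (1 / s) := by
  have hpi := Real.pi_pos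
  have hs0 : 0 < s := by linarith
  have hs1 : 0 < s - 1 := by linarith
  set K : ℝ := (2 * Real.pi)⁻¹ * (2 * 10 ^ s / (s - 1)) with hK
  have hK0 : 0 ≤ K := by positivity
  refine ⟨K ^ (1 / s), fun r h0 h1 => ?_⟩
  have hu : 0 < 1 - r := by linarith
  have havg : Real.circleAverage (fun z => ‖deriv (logHol : ℂ → ℂ) z‖ ^ s) 0 r
      ≤ K * (1 - r) ^ (1 - s) := by
    rw [Real.circleAverage_def, smul_eq_mul, hK, mul_assoc]
    gcongr
    have e : ∫ θ in (0 : ℝ)..2 * Real.pi, ‖deriv (logHol : ℂ → ℂ) (circleMap 0 r θ)‖ ^ s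
        = ∫ θ in -Real.pi..Real.pi, ‖1 - circleMap 0 r θ‖ ^ (-s) := by
      rw [← integral_circleMap_eq (fun z => ‖1 - z‖ ^ (-s)) r]
      refine intervalIntegral.integral_congr fun θ _ => ?_
      have hmem : circleMap 0 r θ ∈ unitDisk :=
        Metric.closedBall_subset_ball h1 (circleMap_mem_closedBall 0 h0 θ)
      simp only [deriv_logHol hmem, norm_inv]
      rw [Real.inv_rpow (norm_nonneg _), Real.rpow_neg (norm_nonneg _)]
    rw [e]
    exact integral_norm_one_sub_circleMap_rpow_le_of_one_lt h0 h1 hs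
  have havg0 : 0 ≤ Real.circleAverage (fun z => ‖deriv (logHol : ℂ → ℂ) z‖ ^ s) 0 r := by
    rw [Real.circleAverage_def, smul_eq_mul]
    exact mul_nonneg (by positivity)
      (intervalIntegral.integral_nonneg (by positivity) fun _ _ => by positivity)
  calc (1 - r) ^ (1 - 1 / s) * integralMean s r (deriv (logHol : ℂ → ℂ))
      ≤ (1 - r) ^ (1 - 1 / s) * (K * (1 - r) ^ (1 - s)) ^ (1 / s) := by
        rw [integralMean]
        gcongr
    _ = K ^ (1 / s) := by
        rw [Real.mul_rpow hK0 (Real.rpow_nonneg hu.le _), ← Real.rpow_mul hu.le,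
          mul_left_comm, ← Real.rpow_add hu]
        rw [show 1 - 1 / s + (1 - s) * (1 / s) = 0 by field_simp; ring, Real.rpow_zero, mul_one]

/-- The values of the kernel integrand of `logHol` on the radius `[0, 1)`. -/
noncomputable def logKernel (α x : ℝ) : ℝ := -Real.log (1 - x) * (1 - x) ^ (-α)

theorem logKernel_nonneg (α : ℝ) {x : ℝ} (h0 : 0 ≤ x) (h1 : x < 1) : 0 ≤ logKernel α x :=
  mul_nonneg (neg_nonneg.2 (Real.log_nonpos (by linarith) (by linarith)))
    (Real.rpow_nonneg (by linarith) _)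

theorem logKernel_mono {α : ℝ} (hα : 0 ≤ α) {x y : ℝ} (h0 : 0 ≤ x) (hxy : x ≤ y) (h1 : y < 1) :
    logKernel α x ≤ logKernel α y := by
  refine mul_le_mul (neg_le_neg (Real.log_le_log (by linarith) (by linarith)))
    (Real.rpow_le_rpow_of_nonpos (by linarith) (by linarith) (by linarith))
    (Real.rpow_nonneg (by linarith) _)
    (neg_nonneg.2 (Real.log_nonpos (by linarith) (by linarith)))

theorem cesaroIntegrand_logHol (α : ℝ) {x : ℝ} (h0 : 0 ≤ x) (h1 : x < 1) :
    cesaroIntegrand α logHol x = logKernel α x := by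
  have hx : (x : ℂ) ∈ unitDisk := by
    rw [mem_ball_zero_iff, Complex.norm_real, Real.norm_of_nonneg h0]
    exact h1
  rw [cesaroIntegrand, logHol_apply hx, logKernel, ← Complex.ofReal_one, ← Complex.ofReal_sub,
    ← Complex.ofReal_log (by linarith), ← Complex.ofReal_neg α,
    ← Complex.ofReal_cpow (by linarith)]
  push_cast
  rfl

theorem measurable_logKernel (α : ℝ) : Measurable (logKernel α) := by
  unfold logKernel
  fun_prop

/-- At a point of the radius the image of the logarithm is an integral without cancellation, so the
pointwise bound on `B_1` bounds the integral of the kernel, uniformly in `ρ`. -/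
theorem lintegral_logKernel_le (μ : Measure (Set.Ico (0 : ℝ) 1)) [IsFiniteMeasure μ] {α : ℝ}
    (hα : 0 < α) (g : BesovOne) (hg : g.toHol = cesaroOp μ α hα logHol) {ρ : ℝ} (h0 : 0 ≤ ρ)
    (h1 : ρ < 1) :
    ∫⁻ t, ENNReal.ofReal (logKernel α ((t : ℝ) * ρ)) ∂μ ≤ ENNReal.ofReal (2 * ‖g‖) := by
  have hρ : (ρ : ℂ) ∈ unitDisk := by
    rw [mem_ball_zero_iff, Complex.norm_real, Real.norm_of_nonneg h0]
    exact h1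
  have ht : ∀ t : Set.Ico (0 : ℝ) 1, 0 ≤ (t : ℝ) * ρ ∧ (t : ℝ) * ρ ≤ ρ := fun t =>
    ⟨mul_nonneg t.2.1 h0, mul_le_of_le_one_left h0 t.2.2.le⟩
  have hnn : ∀ t : Set.Ico (0 : ℝ) 1, 0 ≤ logKernel α ((t : ℝ) * ρ) := fun t =>
    logKernel_nonneg α (ht t).1 ((ht t).2.trans_lt h1)
  -- For fixed `ρ < 1` the kernel is bounded by its value at `ρ`.
  have hint : Integrable (fun t : Set.Ico (0 : ℝ) 1 => logKernel α ((t : ℝ) * ρ)) μ := by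
    refine (integrable_const (logKernel α ρ)).mono' ?_ (Filter.Eventually.of_forall fun t => ?_)
    · exact ((measurable_logKernel α).comp
        (measurable_subtype_coe.mul_const ρ)).aestronglyMeasurable
    · rw [Real.norm_of_nonneg (hnn t)]
      exact logKernel_mono hα.le (ht t).1 (ht t).2 h1
  have e : (g.toHol : ℂ → ℂ) ρ = ((∫ t, logKernel α ((t : ℝ) * ρ) ∂μ : ℝ) : ℂ) := by
    rw [hg, cesaroOp_eq_integral μ hα logHol hρ, ← integral_complex_ofReal]
    refine integral_congr_ae (Filter.Eventually.of_forall fun t => ?_)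
    simp only
    rw [← Complex.ofReal_mul, cesaroIntegrand_logHol α (ht t).1 ((ht t).2.trans_lt h1)]
  have h := g.norm_apply_ofReal_le h0 h1
  rw [e, Complex.norm_real, Real.norm_of_nonneg (integral_nonneg hnn)] at h
  rw [← ofReal_integral_eq_lintegral_ofReal hint (Filter.Eventually.of_forall hnn)]
  exact ENNReal.ofReal_le_ofReal h

/-- With `ℓ = -log (1 - t)`: if `ℓ ≥ 1` then `1 + ℓ ≤ 2ℓ`; if `ℓ ≤ 1` then `(1 - t)^(-α) = e^{αℓ} ≤
e^α`. -/
theorem log_div_rpow_le {α : ℝ} (hα : 0 ≤ α) {t : ℝ} (h0 : 0 ≤ t) (h1 : t < 1) :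
    Real.log (Real.exp 1 / (1 - t)) / (1 - t) ^ α ≤ 2 * Real.exp α + 2 * logKernel α t := by
  have hu : 0 < 1 - t := by linarith
  have hP : 0 < (1 - t) ^ (-α) := Real.rpow_pos_of_pos hu _
  rw [log_exp_one_div h1, div_eq_mul_inv, ← Real.rpow_neg hu.le, logKernel]
  rcases le_total 1 (-Real.log (1 - t)) with h | h
  · have := Real.exp_pos α
    nlinarith
  · have h2 : (1 - t) ^ (-α) ≤ Real.exp α := by
      rw [Real.rpow_def_of_pos hu]
      refine Real.exp_le_exp.2 ?_
      nlinarith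
    have h3 : 0 ≤ -Real.log (1 - t) := neg_nonneg.2 (Real.log_nonpos hu.le (by linarith))
    nlinarith

-- Fatou along `ρ = n/(n+1)` removes `ρ` from the kernel bound; the bounded error in
-- `log_div_rpow_le` is harmless since `μ` is finite.
open Filter Topology in
theorem lintegral_lt_top_of_cesaroOp_logHol (μ : Measure (Set.Ico (0 : ℝ) 1)) [IsFiniteMeasure μ]
    {α : ℝ} (hα : 0 < α) (g : BesovOne) (hg : g.toHol = cesaroOp μ α hα logHol) :
    ∫⁻ t, ENNReal.ofReal
        (Real.log (Real.exp 1 / (1 - (t : ℝ))) / (1 - (t : ℝ)) ^ α) ∂μ < ⊤ := by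
  let ρ : ℕ → ℝ := fun n => n / (n + 1)
  have hρ0 : ∀ n, 0 ≤ ρ n := fun n => by positivity
  have hρ1 : ∀ n, ρ n < 1 := fun n => (div_lt_one (by positivity)).2 (by linarith)
  have hρ : Tendsto ρ atTop (𝓝 1) := tendsto_natCast_div_add_atTop 1
  have hlim : ∀ t : Set.Ico (0 : ℝ) 1,
      Tendsto (fun n => ENNReal.ofReal (logKernel α ((t : ℝ) * ρ n))) atTop
        (𝓝 (ENNReal.ofReal (logKernel α t))) := fun t => by
    have hu : 0 < 1 - (t : ℝ) := by linarith [t.2.2]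
    have hc : ContinuousAt (logKernel α) (t : ℝ) := by
      have h : ContinuousAt (fun x : ℝ => 1 - x) (t : ℝ) := by fun_prop
      exact (h.log hu.ne').neg.mul (h.rpow_const (Or.inl hu.ne'))
    have h2 : Tendsto (fun n => (t : ℝ) * ρ n) atTop (𝓝 (t : ℝ)) := by
      simpa using hρ.const_mul (t : ℝ)
    exact ENNReal.tendsto_ofReal (hc.tendsto.comp h2)
  have hfin : ∫⁻ t : Set.Ico (0 : ℝ) 1, ENNReal.ofReal (logKernel α t) ∂μ
      ≤ ENNReal.ofReal (2 * ‖g‖) := by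
    calc ∫⁻ t : Set.Ico (0 : ℝ) 1, ENNReal.ofReal (logKernel α t) ∂μ
        = ∫⁻ t, liminf (fun n => ENNReal.ofReal (logKernel α ((t : ℝ) * ρ n))) atTop ∂μ :=
          lintegral_congr fun t => (hlim t).liminf_eq.symm
      _ ≤ liminf (fun n => ∫⁻ t, ENNReal.ofReal (logKernel α ((t : ℝ) * ρ n)) ∂μ) atTop :=
          lintegral_liminf_le fun n => ENNReal.measurable_ofReal.comp
            ((measurable_logKernel α).comp (measurable_subtype_coe.mul_const (ρ n)))
      _ ≤ ENNReal.ofReal (2 * ‖g‖) := by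
          refine liminf_le_of_le (by isBoundedDefault) fun b hb => ?_
          obtain ⟨n, hn⟩ := hb.exists
          exact hn.trans (lintegral_logKernel_le μ hα g hg (hρ0 n) (hρ1 n))
  calc _ ≤ ∫⁻ t : Set.Ico (0 : ℝ) 1,
        (ENNReal.ofReal (2 * Real.exp α) + 2 * ENNReal.ofReal (logKernel α t)) ∂μ := by
        refine lintegral_mono fun t => ?_
        refine (ENNReal.ofReal_le_ofReal (log_div_rpow_le hα.le t.2.1 t.2.2)).trans_eq ?_
        have := logKernel_nonneg α t.2.1 t.2.2
        rw [ENNReal.ofReal_add (by positivity) (by positivity), ENNReal.ofReal_mul zero_le_two,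
          ENNReal.ofReal_mul zero_le_two, ENNReal.ofReal_ofNat]
    _ < ⊤ := by
        rw [lintegral_add_left measurable_const, lintegral_const,
          lintegral_const_mul' _ _ (by simp)]
        exact ENNReal.add_lt_top.2 ⟨ENNReal.mul_lt_top ENNReal.ofReal_lt_top (measure_lt_top μ _),
          ENNReal.mul_lt_top (by simp) (hfin.trans_lt ENNReal.ofReal_lt_top)⟩

/-! ### The moment series and the integral condition -/

theorem exists_rpow_mul_exp_neg_le (β : ℝ) (hβ : 0 ≤ β) :
    ∃ C : ℝ, ∀ y : ℝ, 0 ≤ y → y ^ β * (1 + y) * Real.exp (-(y / 2)) ≤ C := by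
  have hlim : Filter.Tendsto (fun y : ℝ => y ^ β * (1 + y) * Real.exp (-(y / 2))) Filter.atTop
      (nhds 0) := by
    have h1 := tendsto_rpow_mul_exp_neg_mul_atTop_nhds_zero β (1 / 2) (by norm_num)
    have h2 := tendsto_rpow_mul_exp_neg_mul_atTop_nhds_zero (β + 1) (1 / 2) (by norm_num)
    have h3 := h1.add h2
    rw [add_zero] at h3
    refine h3.congr' ?_
    filter_upwards [Filter.eventually_gt_atTop 0] with y hy
    rw [Real.rpow_add_one hy.ne', show -(1 / 2) * y = -(y / 2) by ring]
    ring
  have hcont : Continuous fun y : ℝ => y ^ β * (1 + y) * Real.exp (-(y / 2)) :=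
    ((Real.continuous_rpow_const hβ).mul (by fun_prop)).mul (by fun_prop)
  obtain ⟨N, hN⟩ := Filter.eventually_atTop.1 (hlim.eventually_le_const one_pos)
  obtain ⟨C, hC⟩ := (isCompact_Icc (a := (0 : ℝ)) (b := N)).bddAbove_image hcont.continuousOn
  refine ⟨max C 1, fun y hy => ?_⟩
  rcases le_total y N with h | h
  · exact (hC ⟨y, ⟨hy, h⟩, rfl⟩).trans (le_max_left _ _)
  · exact (hN y h).trans (le_max_right _ _)

/-- The `n`-th term of the series `∑ (n+1)^(α-1) log(n+2) t^n`. -/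
noncomputable def logTerm (α t : ℝ) (n : ℕ) : ℝ :=
  ((n : ℝ) + 1) ^ (α - 1) * t ^ n * Real.log (n + 2)

theorem logTerm_nonneg {α t : ℝ} (h0 : 0 ≤ t) (n : ℕ) : 0 ≤ logTerm α t n :=
  mul_nonneg (mul_nonneg (by positivity) (pow_nonneg h0 n))
    (Real.log_nonneg (by linarith [(n.cast_nonneg : (0 : ℝ) ≤ n)]))

/-- In the scale `y = (n+2)(1 - t)` the weights cost `(1 - t)^(1 - α) L` times `y^(α-1) (1 + y)`.
Write `t^n = s^n s^n` with `s = √t`: one factor decays like `e^{-y/2}` and absorbs the powers of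
`y`, the other leaves a geometric series. -/
theorem exists_tsum_logTerm_le {α : ℝ} (hα : 1 ≤ α) :
    ∃ C : ℝ, 0 ≤ C ∧ ∀ t : ℝ, 0 ≤ t → t < 1 →
      ∑' n, ENNReal.ofReal (logTerm α t n)
        ≤ ENNReal.ofReal (C * (Real.log (Real.exp 1 / (1 - t)) / (1 - t) ^ α)) := by
  obtain ⟨C, hC⟩ := exists_rpow_mul_exp_neg_le (α - 1) (by linarith)
  have hC0 : 0 ≤ C := (hC 0 le_rfl).trans' (by positivity)
  have he : 0 < Real.exp 1 := Real.exp_pos 1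
  refine ⟨2 * Real.exp 1 * C, by positivity, fun t h0 h1 => ?_⟩
  have hu : 0 < 1 - t := by linarith
  set L := Real.log (Real.exp 1 / (1 - t)) with hL
  have hL1 : 1 ≤ L := by
    rw [hL, log_exp_one_div h1]
    linarith [Real.log_nonpos hu.le (by linarith)]
  set s := Real.sqrt t with hs
  have hs0 : 0 ≤ s := Real.sqrt_nonneg t
  have hss : s ^ 2 = t := Real.sq_sqrt h0
  have hs1 : s < 1 := by nlinarith
  have hterm : ∀ n : ℕ, logTerm α t n ≤ (Real.exp 1 * C * ((1 - t) ^ (1 - α) * L)) * s ^ n := by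
    intro n
    have hn : (0 : ℝ) ≤ n := n.cast_nonneg
    set y := ((n : ℝ) + 2) * (1 - t) with hy
    have hy0 : 0 < y := by positivity
    have a1 : Real.log (n + 2) ≤ (1 + y) * L := by
      have e : Real.log y = Real.log (n + 2) + Real.log (1 - t) :=
        Real.log_mul (by positivity) hu.ne'
      have := Real.log_le_sub_one_of_pos hy0
      rw [hL, log_exp_one_div h1] at hL1 ⊢
      nlinarith
    have a2 : ((n : ℝ) + 1) ^ (α - 1) ≤ y ^ (α - 1) * (1 - t) ^ (1 - α) := by
      rw [show 1 - α = -(α - 1) by ring, Real.rpow_neg hu.le, ← div_eq_mul_inv,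
        ← Real.div_rpow hy0.le hu.le, hy, mul_div_cancel_right₀ _ hu.ne']
      exact Real.rpow_le_rpow (by positivity) (by linarith) (by linarith)
    have a3 : t ^ n ≤ s ^ n * (Real.exp (-(y / 2)) * Real.exp 1) := by
      have e1 : t ^ n = s ^ n * s ^ n := by rw [← hss]; ring
      rw [e1]
      gcongr
      have e2 : s ≤ Real.exp (-((1 - t) / 2)) := by
        refine (abs_le_of_sq_le_sq ?_ (Real.exp_pos _).le).trans' (le_abs_self _)
        rw [hss, ← Real.exp_nat_mul]
        have := Real.add_one_le_exp (((2 : ℕ) : ℝ) * -((1 - t) / 2))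
        push_cast at this ⊢
        linarith
      calc s ^ n ≤ Real.exp (-((1 - t) / 2)) ^ n := by gcongr
        _ = Real.exp (n * -((1 - t) / 2)) := (Real.exp_nat_mul _ n).symm
        _ ≤ Real.exp (-(y / 2) + 1) := by
            gcongr
            rw [hy]
            nlinarith
        _ = _ := Real.exp_add _ _
    have b1 : 0 ≤ (1 - t) ^ (1 - α) := Real.rpow_nonneg hu.le _
    have b2 : 0 ≤ y ^ (α - 1) := Real.rpow_nonneg hy0.le _
    calc logTerm α t n
        ≤ (y ^ (α - 1) * (1 - t) ^ (1 - α)) * (s ^ n * (Real.exp (-(y / 2)) * Real.exp 1))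
            * ((1 + y) * L) := by
          unfold logTerm
          gcongr
          exact Real.log_nonneg (by linarith)
      _ = (y ^ (α - 1) * (1 + y) * Real.exp (-(y / 2)))
            * (Real.exp 1 * ((1 - t) ^ (1 - α) * L) * s ^ n) := by ring
      _ ≤ C * (Real.exp 1 * ((1 - t) ^ (1 - α) * L) * s ^ n) := by
          gcongr
          exact hC y hy0.le
      _ = _ := by ring
  have b1 : 0 ≤ (1 - t) ^ (1 - α) := Real.rpow_nonneg hu.le _
  set A := Real.exp 1 * C * ((1 - t) ^ (1 - α) * L) with hA
  have hA0 : 0 ≤ A := by positivity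
  calc ∑' n, ENNReal.ofReal (logTerm α t n) ≤ ∑' n : ℕ, ENNReal.ofReal (A * s ^ n) :=
        ENNReal.tsum_le_tsum fun n => ENNReal.ofReal_le_ofReal (hterm n)
    _ = ENNReal.ofReal (A * (1 - s)⁻¹) := by
        rw [← tsum_geometric_of_lt_one hs0 hs1, ← tsum_mul_left, ENNReal.ofReal_tsum_of_nonneg
          (fun n => by positivity) ((summable_geometric_of_lt_one hs0 hs1).mul_left A)]
    _ ≤ _ := by
        refine ENNReal.ofReal_le_ofReal ?_
        -- `1 - t = (1 - s)(1 + s) ≤ 2 (1 - s)`.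
        have e : (1 - s)⁻¹ ≤ 2 * (1 - t)⁻¹ := by
          rw [← div_eq_mul_inv, le_div_iff₀ hu, ← hss, inv_mul_le_iff₀ (by linarith)]
          nlinarith
        refine (mul_le_mul_of_nonneg_left e hA0).trans_eq ?_
        rw [hA, Real.rpow_sub hu, Real.rpow_one]
        field_simp

/-- For `t ≤ 1/2` the term `n = 0` suffices. Otherwise the `N ≈ 1/(1 - t)` terms with `N ≤ n < 2N`
are each at least a constant times `(1 - t)^(1 - α) log (e / (1 - t))`. -/
theorem exists_le_tsum_logTerm {α : ℝ} (hα : 1 ≤ α) :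
    ∃ c : ℝ, 0 ≤ c ∧ ∀ t : ℝ, 0 ≤ t → t < 1 →
      ENNReal.ofReal (Real.log (Real.exp 1 / (1 - t)) / (1 - t) ^ α)
        ≤ ENNReal.ofReal c * ∑' n, ENNReal.ofReal (logTerm α t n) := by
  refine ⟨max (4 * 2 ^ α) (3 * Real.exp 8), by positivity, fun t h0 h1 => ?_⟩
  have hu : 0 < 1 - t := by linarith
  have hlog2 := Real.log_two_gt_d9
  rw [log_exp_one_div h1]
  rcases le_total t (1 / 2) with h | h
  · have hle : (1 - Real.log (1 - t)) / (1 - t) ^ α ≤ 4 * 2 ^ α * logTerm α t 0 := by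
      have e1 : -Real.log (1 - t) ≤ Real.log 2 := by
        rw [← Real.log_inv]
        refine Real.log_le_log (by positivity) ?_
        rw [inv_le_comm₀ hu (by norm_num)]
        linarith
      have e2 : ((1 : ℝ) / 2) ^ α ≤ (1 - t) ^ α :=
        Real.rpow_le_rpow (by norm_num) (by linarith) (by linarith)
      rw [Real.div_rpow (by norm_num) (by norm_num), Real.one_rpow] at e2
      have e3 : logTerm α t 0 = Real.log 2 := by simp [logTerm]
      have h2 : (0 : ℝ) < 2 ^ α := by positivity
      rw [e3, div_le_iff₀ (by positivity)]
      calc 1 - Real.log (1 - t) ≤ 4 * Real.log 2 := by linarith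
        _ = 4 * 2 ^ α * Real.log 2 * (1 / 2 ^ α) := by field_simp
        _ ≤ _ := by gcongr
    calc _ ≤ ENNReal.ofReal (4 * 2 ^ α) * ENNReal.ofReal (logTerm α t 0) := by
          rw [← ENNReal.ofReal_mul (by positivity)]
          exact ENNReal.ofReal_le_ofReal hle
      _ ≤ _ := by
          gcongr
          · exact le_max_left _ _
          · exact ENNReal.le_tsum 0
  · set N := ⌈1 / (1 - t)⌉₊ with hN
    have hN1 : 1 / (1 - t) ≤ N := Nat.le_ceil _
    have hN2 : (N : ℝ) < 1 / (1 - t) + 1 := Nat.ceil_lt_add_one (by positivity)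
    have hx : 2 ≤ 1 / (1 - t) := by rw [le_div_iff₀ hu]; linarith
    have hterm : ∀ n ∈ Finset.Ico N (2 * N),
        Real.exp (-8) * ((1 - t) ^ (1 - α) * ((1 - Real.log (1 - t)) / 3)) ≤ logTerm α t n := by
      intro n hn
      rw [Finset.mem_Ico] at hn
      have hn1 : (N : ℝ) ≤ n := by exact_mod_cast hn.1
      have hn2 : (n : ℝ) ≤ 2 * N := by exact_mod_cast hn.2.le
      -- `log t ≥ -2 (1 - t)` for `t ≥ 1/2`, and `n (1 - t) ≤ 4` on the block.
      have a1 : Real.exp (-8) ≤ t ^ n := by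
        have e1 : -(2 * (1 - t)) ≤ Real.log t := by
          have := Real.one_sub_inv_le_log_of_pos (show 0 < t by linarith)
          have e : t⁻¹ ≤ 1 + 2 * (1 - t) := by
            rw [inv_le_iff_one_le_mul₀ (by linarith)]
            nlinarith
          linarith
        rw [show t ^ n = Real.exp (n * Real.log t) by
          rw [Real.exp_nat_mul, Real.exp_log (show 0 < t by linarith)]]
        refine Real.exp_le_exp.2 ?_
        have e2 : (n : ℝ) * (1 - t) ≤ 4 := by
          have : (n : ℝ) ≤ 4 * (1 / (1 - t)) := by linarith
          calc (n : ℝ) * (1 - t) ≤ 4 * (1 / (1 - t)) * (1 - t) := by gcongr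
            _ = 4 := by field_simp
        have : (0 : ℝ) ≤ n := n.cast_nonneg
        nlinarith
      have a2 : (1 - t) ^ (1 - α) ≤ ((n : ℝ) + 1) ^ (α - 1) := by
        rw [show 1 - α = -(α - 1) by ring, Real.rpow_neg hu.le, ← Real.inv_rpow hu.le, ← one_div]
        exact Real.rpow_le_rpow (by positivity) (by linarith) (by linarith)
      have a3 : (1 - Real.log (1 - t)) / 3 ≤ Real.log (n + 2) := by
        have e1 : -Real.log (1 - t) ≤ Real.log (n + 2) := by
          rw [← Real.log_inv, ← one_div]
          exact Real.log_le_log (by positivity) (by linarith)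
        have e2 : Real.log 2 ≤ Real.log (n + 2) :=
          Real.log_le_log (by norm_num) (by linarith)
        linarith
      have b1 : 0 ≤ (1 - t) ^ (1 - α) := Real.rpow_nonneg hu.le _
      have b2 : 0 ≤ 1 - Real.log (1 - t) := by linarith [Real.log_nonpos hu.le (by linarith)]
      calc _ ≤ t ^ n * (((n : ℝ) + 1) ^ (α - 1) * Real.log (n + 2)) := by gcongr
        _ = logTerm α t n := by unfold logTerm; ring
    have hle : (1 - Real.log (1 - t)) / (1 - t) ^ α
        ≤ 3 * Real.exp 8 * ∑ n ∈ Finset.Ico N (2 * N), logTerm α t n := by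
      have hs := Finset.card_nsmul_le_sum _ _ _ hterm
      rw [Nat.card_Ico, show 2 * N - N = N by omega, nsmul_eq_mul] at hs
      have b1 : 0 ≤ (1 - t) ^ (1 - α) := Real.rpow_nonneg hu.le _
      have b2 : 0 ≤ 1 - Real.log (1 - t) := by linarith [Real.log_nonpos hu.le (by linarith)]
      calc (1 - Real.log (1 - t)) / (1 - t) ^ α
          = 3 * Real.exp 8 * (1 / (1 - t) * (Real.exp (-8) * ((1 - t) ^ (1 - α)
              * ((1 - Real.log (1 - t)) / 3)))) := by
            rw [Real.rpow_sub hu, Real.rpow_one, Real.exp_neg]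
            field_simp
        _ ≤ 3 * Real.exp 8 * (N * (Real.exp (-8) * ((1 - t) ^ (1 - α)
              * ((1 - Real.log (1 - t)) / 3)))) := by gcongr
        _ ≤ _ := by gcongr
    calc _ ≤ ENNReal.ofReal (3 * Real.exp 8)
            * ∑ n ∈ Finset.Ico N (2 * N), ENNReal.ofReal (logTerm α t n) := by
          rw [← ENNReal.ofReal_sum_of_nonneg fun n _ => logTerm_nonneg h0 n,
            ← ENNReal.ofReal_mul (by positivity)]
          exact ENNReal.ofReal_le_ofReal hle
      _ ≤ _ := by
          gcongr
          · exact le_max_right _ _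
          · exact ENNReal.sum_le_tsum _

/-- All terms are nonnegative, so sum and `μ`-integral may be exchanged in `ENNReal`; the two-sided
comparison of the series in `t` then applies under the integral. -/
theorem summable_moment_iff (μ : Measure (Set.Ico (0 : ℝ) 1)) [IsFiniteMeasure μ] {α : ℝ}
    (hα : 1 ≤ α) :
    (Summable fun n : ℕ => ((n : ℝ) + 1) ^ (α - 1) * moment μ n * Real.log (n + 2)) ↔
      ∫⁻ t, ENNReal.ofReal
        (Real.log (Real.exp 1 / (1 - (t : ℝ))) / (1 - (t : ℝ)) ^ α) ∂μ < ⊤ := by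
  have hpow : ∀ n : ℕ, Integrable (fun t : Set.Ico (0 : ℝ) 1 => (t : ℝ) ^ n) μ := fun n =>
    (integrable_const (1 : ℝ)).mono' (Continuous.aestronglyMeasurable (by fun_prop))
      (Filter.Eventually.of_forall fun t => by
        rw [Real.norm_of_nonneg (pow_nonneg t.2.1 n)]
        exact pow_le_one₀ t.2.1 t.2.2.le)
  have hlog : ∀ n : ℕ, 0 ≤ Real.log ((n : ℝ) + 2) := fun n =>
    Real.log_nonneg (by linarith [(n.cast_nonneg : (0 : ℝ) ≤ n)])
  have hmom : ∀ n, 0 ≤ moment μ n := fun n => integral_nonneg fun t => pow_nonneg t.2.1 n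
  have e : ∀ n : ℕ, ENNReal.ofReal (((n : ℝ) + 1) ^ (α - 1) * moment μ n * Real.log (n + 2))
      = ∫⁻ t, ENNReal.ofReal (logTerm α t n) ∂μ := fun n => by
    have hi : Integrable (fun t : Set.Ico (0 : ℝ) 1 => logTerm α t n) μ :=
      ((hpow n).const_mul _).mul_const _
    rw [← ofReal_integral_eq_lintegral_ofReal hi
      (Filter.Eventually.of_forall fun t => logTerm_nonneg t.2.1 n)]
    unfold logTerm
    rw [integral_mul_const, integral_const_mul, moment]
  have hmeas : ∀ n, Measurable fun t : Set.Ico (0 : ℝ) 1 => ENNReal.ofReal (logTerm α t n) :=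
    fun n => by unfold logTerm; fun_prop
  have hsum : ∑' n : ℕ, ENNReal.ofReal (((n : ℝ) + 1) ^ (α - 1) * moment μ n * Real.log (n + 2))
      = ∫⁻ t : Set.Ico (0 : ℝ) 1, ∑' n, ENNReal.ofReal (logTerm α t n) ∂μ := by
    rw [lintegral_tsum fun n => (hmeas n).aemeasurable]
    exact tsum_congr e
  have hiff : (Summable fun n : ℕ => ((n : ℝ) + 1) ^ (α - 1) * moment μ n * Real.log (n + 2)) ↔
      ∑' n : ℕ, ENNReal.ofReal (((n : ℝ) + 1) ^ (α - 1) * moment μ n * Real.log (n + 2)) ≠ ⊤ := by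
    refine ⟨fun h => h.tsum_ofReal_ne_top, fun h => ?_⟩
    refine (ENNReal.summable_toReal h).congr fun n => ?_
    exact ENNReal.toReal_ofReal (mul_nonneg (mul_nonneg (by positivity) (hmom n)) (hlog n))
  rw [hiff, hsum, ← lt_top_iff_ne_top]
  constructor
  · intro h
    obtain ⟨c, hc0, hc⟩ := exists_le_tsum_logTerm hα
    refine (lintegral_mono fun t : Set.Ico (0 : ℝ) 1 => hc t t.2.1 t.2.2).trans_lt ?_
    rw [lintegral_const_mul' _ _ ENNReal.ofReal_ne_top]
    exact ENNReal.mul_lt_top ENNReal.ofReal_lt_top h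
  · intro h
    obtain ⟨C, hC0, hC⟩ := exists_tsum_logTerm_le hα
    refine (lintegral_mono fun t : Set.Ico (0 : ℝ) 1 => hC t t.2.1 t.2.2).trans_lt ?_
    simp_rw [ENNReal.ofReal_mul hC0]
    rw [lintegral_const_mul' _ _ ENNReal.ofReal_ne_top]
    exact ENNReal.mul_lt_top ENNReal.ofReal_lt_top h

theorem mainTheorem2 (α s : ℝ) (hα : 1 ≤ α) (hs : 1 < s)
    (μ : Measure (Set.Ico (0 : ℝ) 1)) [IsFiniteMeasure μ]
    -- `X` is a Banach subspace of `H(𝔻)`: a linear subspace (the range of the injection `ι`) with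
    -- a complete norm for which the point evaluations are continuous
    {X : Type*} [NormedAddCommGroup X] [NormedSpace ℂ X] [CompleteSpace X]
    (ι : X →ₗ[ℂ] HolDisk) (hι : Function.Injective ι)
    (hev : ∀ z ∈ unitDisk, Continuous fun x => (ι x : ℂ → ℂ) z)
    (hΛX : meanLipschitzSpace s (1 / s) ⊆ Set.range ι)
    (hXB : Set.range ι ⊆ blochSpace) :
    List.TFAE
      [IsBoundedToBesovOne ι (cesaroOp μ α (zero_lt_one.trans_le hα)),
       IsCompactToBesovOne ι (cesaroOp μ α (zero_lt_one.trans_le hα)),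
       Summable fun n : ℕ => ((n : ℝ) + 1) ^ (α - 1) * moment μ n * Real.log (n + 2),
       ∫⁻ t, ENNReal.ofReal (Real.log (Real.exp 1 / (1 - (t : ℝ))) / (1 - (t : ℝ)) ^ α) ∂μ < ⊤] := by
  tfae_have 2 → 1 := fun ⟨S, _, hS⟩ => ⟨S, hS⟩
  tfae_have 3 ↔ 4 := summable_moment_iff μ hα
  tfae_have 4 → 2 := isCompactToBesovOne_cesaroOp μ hα ι hev hXB
  -- The inclusion of the mean Lipschitz space in `X` supplies the logarithm as test function.
  tfae_have 1 → 4 := by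
    rintro ⟨S, hS⟩
    obtain ⟨x, hx⟩ := hΛX (logHol_mem_meanLipschitzSpace hs)
    exact lintegral_lt_top_of_cesaroOp_logHol μ (zero_lt_one.trans_le hα) (S x) (by rw [hS, hx])
  tfae_finish
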